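/- **Conventions.** Algebras are nonempty; all operations have finite arity. For an algebra $A$, $\mathrm{Con}_c A$ is the $(\vee,0)$-semilattice of finitely generated congruences of $A$, and $\Theta_A(x,y)$ is the principal congruence generated by $(x,y)$; $\mathrm{Con}_c$ is a functor. An ideal of a $(\vee,0)$-semilattice $S$ is a lower subset containing $0$ and closed under $\vee$; $S/I$ is the quotient of $S$ by the congruence $\{(a,b) : a\vee c=b\vee c \text{ for some } c\in I\}$. An ideal of a poset is a nonempty, upward directed lower subset. For a poset $P$, $\mathrm{Max}\,P$ is the set of its maximal elements and $P^{=}=P\setminus \mathrm{Max}\,P$. **Gamps.** A *partial algebra* $A$ is a set with a partial operation $\ell:\mathrm{Def}_\ell(A)\to A$, $\mathrm{Def}_\ell(A)\subseteq A^{n}$, for each $n$-ary operation symbol $\ell$; a morphism $f:A\to B$ is a map such that $\vec x\in\mathrm{Def}_\ell(A)$ implies $f(\vec x)\in\mathrm{Def}_\ell(B)$ and $\ell(f(\vec x))=f(\ell(\vec x))$. A *partial subalgebra* $B$ of $A$ is a subset with partial operations that are restrictions of those of $A$; it is *strong* in $A$ if $B^{n}\subseteq\mathrm{Def}_\ell(A)$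 for every $n$-ary $\ell$. The image $f(A)$ has $\mathrm{Def}_\ell(f(A))=f(\mathrm{Def}_\ell(A))$. A partial algebra satisfies $t_1=t_2$ if $t_1(\vec x)=t_2(\vec x)$ whenever both sides are defined. A *gamp* is a quadruple $\mathbf A=(A^*,A,\delta,\widetilde A)$, where $A$ is a partial algebra, $A^*$ is a partial subalgebra of $A$, $\widetilde A$ is a $(\vee,0)$-semilattice, and $\delta:A^2\to\widetilde A$ satisfies: $\delta(x,y)=0$ iff $x=y$; $\delta(x,y)=\delta(y,x)$; $\delta(x,y)\le\delta(x,z)\vee\delta(z,y)$; and $\delta(\ell(\vec x),\ell(\vec y))\le\bigvee_k\delta(x_k,y_k)$ for $\vec x,\vec y\in\mathrm{Def}_\ell(A)$. A *morphism* $\mathbf A\to\mathbf B$ is a pair $(f,\widetilde f)$ of a morphism of partial algebras $f:A\to B$ and a $(\vee,0)$-homomorphism $\widetilde f:\widetilde A\to\widetilde B$ such that $\delta_{\mathbf B}(f(x),f(y))=\widetilde f(\delta_{\mathbf A}(x,y))$ and $f(A^*)$ is a partial subalgebra of $B^*$. For an ideal $I$ of $\widetilde A$, the *quotient* $\mathbf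 A/I$ is $(A^*/I,A/I,\delta/I,\widetilde A/I)$, where $A/I$ is the quotient of $A$ by the equivalence $\delta(x,y)\in I$, with $\mathrm{Def}_\ell(A/I)=\{\vec x/I:\vec x\in\mathrm{Def}_\ell(A)\}$ and $\ell(\vec x/I)=\ell(\vec x)/I$, where $A^*/I$ is the image of $A^*$, and where $(\delta/I)(x/I,y/I)=\delta(x,y)/I$. The gamp is *finite* if $A$ and $\widetilde A$ are finite; it is a gamp *of a variety* $\mathcal W$ if for every ideal $I$ of $\widetilde A$ the partial algebra $A/I$ satisfies all identities of $\mathcal W$. For an algebra $B$, $\mathrm{GA}(B)=(B,B,\Theta_B,\mathrm{Con}_c B)$. A gamp $\mathbf A$ is *strong* if $A^*$ is strong in $A$; *distance-generated* if every element of $\widetilde A$ is a finite join of elements $\delta(x,y)$ with $x,y\in A^*$; *congruence-tractable* if, whenever $\delta(x,y)\le\bigvee_{k<m}\delta(x_k,y_k)$ with all elements in $A^*$, there are $n>0$, a list $\vec z$ of parameters in $A$ and terms $t_0,\dots,t_n$ with $x=t_0(\vec x,\vec y,\vec z)$, $y=t_n(\vec x,\vec y,\vec z)$ and $t_j(\vec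 y,\vec x,\vec z)=t_{j+1}(\vec x,\vec y,\vec z)$ for $j<n$, all these values being defined in $A$. An *isomorphic realization* of $\mathbf A$ in $\mathcal W$ is an algebra $A'\in\mathcal W$ containing $A$ as a partial subalgebra, with an isomorphism $\chi:\widetilde A\to\mathrm{Con}_c A'$ such that $\chi(\delta(x,y))=\Theta_{A'}(x,y)$ for $x,y\in A$. A morphism $(f,\widetilde f):\mathbf A\to\mathbf B$ is *strong* if $f(A)$ is a partial subalgebra of $B^*$ that is strong in $B^*$; it is *congruence-cuttable* if $f(A)$ is a partial subalgebra of $B^*$ and, for every finite $X\subseteq\widetilde B$ and $x,y\in A$ with $\delta_{\mathbf B}(f(x),f(y))\le\bigvee X$, there are $n<\omega$ and $f(x)=x_0,\dots,x_n=f(y)$ in $B^*$ such that each $\delta_{\mathbf B}(x_k,x_{k+1})$, $k<n$, is below some element of $X$. A *partial lifting* in $\mathcal W$ of a $P$-indexed diagram $\vec S$ of $(\vee,0)$-semilattices is a $P$-indexed diagram $\vec{\mathbf B}=(\mathbf B_p,\mathbf g_{p,q})_{p\le q}$ of gamps of $\mathcal W$ such that every $\mathbf B_p$ is strong, distance-generated,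 congruence-tractable and has an isomorphic realization in $\mathcal W$, every $\mathbf g_{p,q}$ with $p<q$ is strong and congruence-cuttable, and the diagram $(\widetilde B_p,\widetilde g_{p,q})_{p\le q}$ is isomorphic to $\vec S$. **Lifters and condensates.** A finite subset $V$ of a poset $X$ is a *kernel* if for every $u\in X$ there is a largest $v\in V$ with $v\le u$; it is denoted by $V\cdot u$. The poset $X$ is *supported* if every finite subset of $X$ is contained in a kernel. A *norm-covering* of a poset $P$ is a supported poset $X$ with an isotone map $\partial:X\to P$. An ideal $\mathbf x$ of $X$ is *sharp* if $\{\partial u:u\in\mathbf x\}$ has a largest element, denoted by $\partial\mathbf x$. An *$\aleph_0$-lifter* of $P$ is a pair $(X,\mathbf X)$ of a norm-covering $X$ of $P$ and a set $\mathbf X$ of sharp ideals of $X$, ordered by inclusion, such that, with $\mathbf X^{=}=\{\mathbf x\in\mathbf X:\partial\mathbf x\notin\mathrm{Max}\,P\}$: (1) $\{\mathbf y\in\mathbf X:\mathbf y\subseteq\mathbf x\}$ is finite for every $\mathbf x\in\mathbf X^{=}$; (2) for every map $S$ from $\mathbf X^{=}$ to the finite subsets of $X$ there is an isotone map $\sigma:P\to\mathbf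 X$ such that $\partial\sigma(p)=p$ for all $p\in P$ and $S(\sigma(p))\cap\sigma(q)\subseteq\sigma(p)$ for all $p<q$ in $P$. For a norm-covering $X$ of $P$ and a $P$-indexed diagram $\vec A=(A_p,f_{p,q})_{p\le q}$ of algebras, the *condensate* $\mathbf F(X)\otimes\vec A$ is the directed colimit, over the kernels $V$ of $X$ ordered by inclusion, of the products $\prod_{v\in V}A_{\partial v}$, the map for $V\subseteq V'$ sending $a$ to $\bigl(f_{\partial(V\cdot v),\partial v}(a_{V\cdot v})\bigr)_{v\in V'}$; equivalently, it is the subalgebra of $\prod_{u\in X}A_{\partial u}$ of all $a$ for which there is a kernel $V$ with $a_u=f_{\partial(V\cdot u),\partial u}(a_{V\cdot u})$ for all $u\in X$. **Theorem (Condensate Lifting Lemma for gamps).** Let $\mathcal V$ and $\mathcal W$ be varieties of algebras such that $\mathcal W$ has finite similarity type, let $(X,\mathbf X)$ be an $\aleph_0$-lifter of a poset $P$, let $\vec A=(A_p,f_{p,q})_{p\le q\text{ in }P}$ be a diagram in $\mathcal V$ such that $\mathrm{Con}_c A_p$ is finite for each $p\in P^{=}$, and let $B\in\mathcal W$ be such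 that $\mathrm{Con}_c B\cong\mathrm{Con}_c(\mathbf F(X)\otimes\vec A)$. Then there is a partial lifting $\vec{\mathbf B}=(\mathbf B_p,\mathbf g_{p,q})_{p\le q\text{ in }P}$ of $\mathrm{Con}_c\circ\vec A$ in $\mathcal W$ such that $\mathbf B_p$ is finite for each $p\in P^{=}$ and $\mathbf B_p$ is isomorphic to a quotient of $\mathrm{GA}(B)$ for each $p\in\mathrm{Max}\,P$. -/

import Mathlib

/-!
Universal algebra is done over a first-order language `L` without relation symbols
(`L.IsAlgebraic`), whose function symbols form the similarity type.
-/



open scoped FirstOrder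

namespace CLLGamp

universe u u' v v' w x y

/-! ### Varieties -/

/-- A variety of `L`-algebras, given by a set of defining identities `s = t`. -/
structure Variety (L : FirstOrder.Language.{u, u'}) where
  /-- The defining identities. -/
  axioms : Set (L.Term ℕ × L.Term ℕ)

namespace Variety

variable {L : FirstOrder.Language.{u, u'}}

/-- Membership of an algebra in a variety. As usual, algebras are nonempty. -/
def Mem (V : Variety L) (A : Type v) [L.Structure A] : Prop :=
  Nonempty A ∧ ∀ e ∈ V.axioms, ∀ a : ℕ → A, e.1.realize a = e.2.realize a

/-- `s = t` is an identity of `V`, that is, it holds in all members of `V`. (Every countably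
generated algebra is isomorphic to one in the universe of the symbols of `L`, so that the universe
of `A` is no restriction.) -/
def IsIdentity (V : Variety L) (s t : L.Term ℕ) : Prop :=
  ∀ (A : Type u) [L.Structure A], V.Mem A → ∀ a : ℕ → A, s.realize a = t.realize a

end Variety

/-! ### Congruences -/

/-- A congruence of the algebra `A`. -/
structure Cong (L : FirstOrder.Language.{u, u'}) (A : Type v) [L.Structure A] extends Setoid A where
  compat : ∀ {n : ℕ} (f : L.Functions n) (a b : Fin n → A),
    (∀ i, r (a i) (b i)) → r (FirstOrder.Language.Structure.funMap f a) (FirstOrder.Language.Structure.funMap f b)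

namespace Cong

variable {L : FirstOrder.Language.{u, u'}} {A : Type v} [L.Structure A] {B : Type v'} [L.Structure B]

theorem ext' {α β : Cong L A} (h : ∀ a b, α.r a b ↔ β.r a b) : α = β := by
  cases α with
  | mk s hs =>
    cases β with
    | mk t ht =>
      have : s = t := Setoid.ext h
      subst this
      rfl

/-- Congruences are ordered by inclusion. -/
instance : PartialOrder (Cong L A) where
  le α β := ∀ a b, α.r a b → β.r a b
  le_refl _ _ _ h := h
  le_trans _ _ _ h₁ h₂ a b h := h₂ a b (h₁ a b h)
  le_antisymm _ _ h₁ h₂ := ext' fun a b => ⟨h₁ a b, h₂ a b⟩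

theorem le_def {α β : Cong L A} : α ≤ β ↔ ∀ a b, α.r a b → β.r a b := Iff.rfl

instance : InfSet (Cong L A) where
  sInf F :=
    { r := fun a b => ∀ α ∈ F, α.r a b
      iseqv :=
        ⟨fun a α _ => α.iseqv.refl a, fun h α hα => α.iseqv.symm (h α hα),
          fun h₁ h₂ α hα => α.iseqv.trans (h₁ α hα) (h₂ α hα)⟩
      compat := fun f a b h α hα => α.compat f a b fun i => h i α hα }

theorem sInf_r {S : Set (Cong L A)} {a b : A} : (sInf S).r a b ↔ ∀ α ∈ S, α.r a b := Iff.rfl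

/-- The lattice `Con A`. -/
instance : CompleteLattice (Cong L A) :=
  completeLatticeOfInf _ fun S =>
    ⟨fun α hα _ _ h => h α hα, fun _ hβ a b h α hα => hβ hα a b h⟩

/-- The principal congruence `Θ_A(a, b)`. -/
def principal (L : FirstOrder.Language.{u, u'}) {A : Type v} [L.Structure A] (a b : A) : Cong L A :=
  sInf {α | α.r a b}

theorem principal_le {a b : A} {α : Cong L A} : principal L a b ≤ α ↔ α.r a b :=
  ⟨fun h => h a b fun _ hβ => hβ, fun h => sInf_le h⟩

/-- The equality congruence. -/
def equality (L : FirstOrder.Language.{u, u'}) (A : Type v) [L.Structure A] : Cong L A where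
  r := Eq
  iseqv := eq_equivalence
  compat f a b h := by rw [funext h]

theorem bot_r {a b : A} : (⊥ : Cong L A).r a b ↔ a = b :=
  ⟨fun h => (bot_le : (⊥ : Cong L A) ≤ equality L A) a b h, fun h => h ▸ (⊥ : Cong L A).iseqv.refl a⟩

/-- A congruence is finitely generated if it is a finite join of principal congruences. -/
def IsFG (α : Cong L A) : Prop :=
  ∃ s : Finset (A × A), α = s.sup fun e => principal L e.1 e.2

/-- The congruence of `B` generated by the image of the congruence `α` of `A` under `f`. -/
def map (f : A →[L] B) (α : Cong L A) : Cong L B :=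
  sInf {β | ∀ a b, α.r a b → β.r (f a) (f b)}

/-- The preimage of a congruence. -/
def comap (f : A →[L] B) (β : Cong L B) : Cong L A where
  r a b := β.r (f a) (f b)
  iseqv := ⟨fun _ => β.iseqv.refl _, fun h => β.iseqv.symm h, fun h₁ h₂ => β.iseqv.trans h₁ h₂⟩
  compat g a b h := by
    rw [f.map_fun, f.map_fun]
    exact β.compat g _ _ h

theorem gc (f : A →[L] B) : GaloisConnection (map f) (comap f) := fun α β =>
  ⟨fun h a b hab => h _ _ fun _ hγ => hγ a b hab, fun h => sInf_le h⟩

theorem map_principal (f : A →[L] B) (a b : A) :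
    map f (principal L a b) = principal L (f a) (f b) :=
  eq_of_forall_ge_iff fun γ => by
    rw [gc f, principal_le, principal_le]
    rfl

theorem isFG_principal (a b : A) : IsFG (principal L a b) := ⟨{(a, b)}, by simp⟩

theorem isFG_bot : IsFG (⊥ : Cong L A) := ⟨∅, by simp⟩

theorem IsFG.sup {α β : Cong L A} (hα : IsFG α) (hβ : IsFG β) : IsFG (α ⊔ β) := by
  classical
  obtain ⟨s, rfl⟩ := hα
  obtain ⟨t, rfl⟩ := hβ
  exact ⟨s ∪ t, Finset.sup_union.symm⟩

theorem map_finset_sup (f : A →[L] B) (s : Finset (A × A)) :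
    map f (s.sup fun e => principal L e.1 e.2) = s.sup fun e => principal L (f e.1) (f e.2) := by
  classical
  induction s using Finset.induction_on with
  | empty => simpa using (gc f).l_bot
  | insert e s _ ih => rw [Finset.sup_insert, Finset.sup_insert, (gc f).l_sup, ih, map_principal]

theorem IsFG.map {α : Cong L A} (hα : IsFG α) (f : A →[L] B) : IsFG (map f α) := by
  classical
  obtain ⟨s, rfl⟩ := hα
  refine ⟨s.image fun e => (f e.1, f e.2), ?_⟩
  rw [map_finset_sup, Finset.sup_image]
  rfl

end Cong

/-- The `(∨, 0)`-semilattice `Con_c A` of finitely generated (that is, compact) congruences. -/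
def Conc (L : FirstOrder.Language.{u, u'}) (A : Type v) [L.Structure A] : Type v :=
  {α : Cong L A // α.IsFG}

namespace Conc

variable {L : FirstOrder.Language.{u, u'}} {A : Type v} [L.Structure A] {B : Type v'} [L.Structure B]

instance : SemilatticeSup (Conc L A) :=
  Subtype.semilatticeSup fun _ _ hα hβ => Cong.IsFG.sup hα hβ

instance : OrderBot (Conc L A) := Subtype.orderBot Cong.isFG_bot

/-- `Θ_A(a, b)` as an element of `Con_c A`. -/
def principal (L : FirstOrder.Language.{u, u'}) {A : Type v} [L.Structure A] (a b : A) : Conc L A :=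
  ⟨Cong.principal L a b, Cong.isFG_principal a b⟩

theorem principal_le {a b : A} {α : Conc L A} : principal L a b ≤ α ↔ α.1.r a b :=
  Cong.principal_le

/-- The `(∨, 0)`-homomorphism `Con_c f`. -/
def map (f : A →[L] B) : SupBotHom (Conc L A) (Conc L B) where
  toFun α := ⟨Cong.map f α.1, α.2.map f⟩
  map_sup' _ _ := Subtype.ext (Cong.gc f).l_sup
  map_bot' := Subtype.ext (Cong.gc f).l_bot

end Conc

/-! ### Quotients of `(∨, 0)`-semilattices by ideals -/

section SemilatticeQuotient

variable {S : Type v} [SemilatticeSup S] [OrderBot S]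

/-- The congruence `θ_I = {(a, b) | ∃ c ∈ I, a ∨ c = b ∨ c}`. -/
def idealSetoid (I : Order.Ideal S) : Setoid S where
  r a b := ∃ c ∈ I, a ⊔ c = b ⊔ c
  iseqv :=
    ⟨fun _ => ⟨⊥, I.bot_mem, rfl⟩, fun ⟨c, hc, h⟩ => ⟨c, hc, h.symm⟩, by
      rintro a b d ⟨c, hc, h⟩ ⟨c', hc', h'⟩
      refine ⟨c ⊔ c', Order.Ideal.sup_mem hc hc', ?_⟩
      rw [← sup_assoc, h, sup_right_comm, h', sup_right_comm, sup_assoc]⟩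

/-- The quotient `S / I`. -/
def SemiQuot (I : Order.Ideal S) : Type v := Quotient (idealSetoid I)

namespace SemiQuot

variable {I : Order.Ideal S}

/-- The canonical projection. -/
def mk (I : Order.Ideal S) (a : S) : SemiQuot I := Quotient.mk (idealSetoid I) a

theorem mk_eq {a b : S} : mk I a = mk I b ↔ ∃ c ∈ I, a ⊔ c = b ⊔ c := Quotient.eq (r := idealSetoid I)

theorem mk_surjective (I : Order.Ideal S) : Function.Surjective (mk I) := Quotient.mk_surjective

/-- The join of `S / I`, induced by that of `S`. -/
def join : SemiQuot I → SemiQuot I → SemiQuot I :=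
  Quotient.map₂ (· ⊔ ·) (by
    rintro a a' ⟨c, hc, h⟩ b b' ⟨d, hd, h'⟩
    refine ⟨c ⊔ d, Order.Ideal.sup_mem hc hd, ?_⟩
    rw [sup_sup_sup_comm, h, h', sup_sup_sup_comm])

instance : SemilatticeSup (SemiQuot I) :=
  @SemilatticeSup.mk' _ ⟨join⟩
    (by
      intro p q
      obtain ⟨a, rfl⟩ := mk_surjective I p
      obtain ⟨b, rfl⟩ := mk_surjective I q
      exact congrArg (mk I) (sup_comm a b))
    (by
      intro p q r
      obtain ⟨a, rfl⟩ := mk_surjective I p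
      obtain ⟨b, rfl⟩ := mk_surjective I q
      obtain ⟨c, rfl⟩ := mk_surjective I r
      exact congrArg (mk I) (sup_assoc a b c))
    (by
      intro p
      obtain ⟨a, rfl⟩ := mk_surjective I p
      exact congrArg (mk I) (sup_idem a))

theorem mk_sup (a b : S) : mk I (a ⊔ b) = mk I a ⊔ mk I b := rfl

instance : OrderBot (SemiQuot I) where
  bot := mk I ⊥
  bot_le p := by
    obtain ⟨a, rfl⟩ := mk_surjective I p
    rw [← sup_eq_right]
    exact (mk_sup ⊥ a).symm.trans (by rw [bot_sup_eq])

theorem mk_bot : mk I (⊥ : S) = ⊥ := rfl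

theorem mk_eq_bot {a : S} : mk I a = ⊥ ↔ a ∈ I := by
  rw [← mk_bot, mk_eq]
  constructor
  · rintro ⟨c, hc, h⟩
    rw [bot_sup_eq] at h
    exact I.lower (sup_eq_right.1 h) hc
  · exact fun h => ⟨a, h, by simp⟩

theorem mk_mono {a b : S} (h : a ≤ b) : mk I a ≤ mk I b := by
  rw [← sup_eq_right, ← mk_sup, sup_eq_right.2 h]

theorem mk_finset_sup {ι : Type*} (s : Finset ι) (f : ι → S) :
    mk I (s.sup f) = s.sup fun i => mk I (f i) := by
  classical
  induction s using Finset.induction_on with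
  | empty => rfl
  | insert i s _ ih => rw [Finset.sup_insert, Finset.sup_insert, mk_sup, ih]

end SemiQuot

end SemilatticeQuotient

/-! ### Partial algebras -/

/-- A partial algebra with universe `A`: each symbol `f` is interpreted by a partial operation,
given by its graph; `graph f a b` says that `f(a)` is defined and equal to `b`. -/
structure PartialAlg (L : FirstOrder.Language.{u, u'}) (A : Type v) where
  graph : ∀ {n : ℕ}, L.Functions n → (Fin n → A) → A → Prop
  functional : ∀ {n : ℕ} {f : L.Functions n} {a : Fin n → A} {b c : A},
    graph f a b → graph f a c → b = c

namespace PartialAlg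

variable {L : FirstOrder.Language.{u, u'}} {A : Type v}

/-- An algebra, as a partial algebra. -/
def ofAlgebra (L : FirstOrder.Language.{u, u'}) (A : Type v) [L.Structure A] : PartialAlg L A where
  graph f a b := FirstOrder.Language.Structure.funMap f a = b
  functional h₁ h₂ := h₁.symm.trans h₂

/-- `M.Eval a t b`: the term `t` is defined at the assignment `a` and takes the value `b`. -/
def Eval (M : PartialAlg L A) {V : Type v'} (a : V → A) : L.Term V → A → Prop
  | .var i, b => a i = b
  | .func f ts, b => ∃ c, (∀ i, Eval M a (ts i) (c i)) ∧ M.graph f c b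

/-- Satisfaction of the identity `s = t`: both sides agree wherever both are defined. -/
def Satisfies (M : PartialAlg L A) (s t : L.Term ℕ) : Prop :=
  ∀ (a : ℕ → A) (b c : A), M.Eval a s b → M.Eval a t c → b = c

end PartialAlg

/-- A partial subalgebra of `M`: a subset with partial operations that are restrictions of those
of `M`. The operation of the subalgebra may have a smaller domain than the one induced by `M`. -/
structure PartialSub {L : FirstOrder.Language.{u, u'}} {A : Type v} (M : PartialAlg L A) where
  carrier : Set A
  graph : ∀ {n : ℕ}, L.Functions n → (Fin n → A) → A → Prop
  mem_of_graph : ∀ {n : ℕ} {f : L.Functions n} {a : Fin n → A} {b : A},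
    graph f a b → (∀ i, a i ∈ carrier) ∧ b ∈ carrier
  graph_le : ∀ {n : ℕ} {f : L.Functions n} {a : Fin n → A} {b : A}, graph f a b → M.graph f a b

/-! ### Pregamps and gamps -/

/-- A pregamp `(A, δ, S)`: a partial algebra with a distance with values in a
`(∨, 0)`-semilattice. -/
structure Pregamp (L : FirstOrder.Language.{u, u'}) where
  carrier : Type w
  alg : PartialAlg L carrier
  dist : Type w
  [sup : SemilatticeSup dist]
  [bot : OrderBot dist]
  δ : carrier → carrier → dist
  δ_eq_bot : ∀ a b, δ a b = ⊥ ↔ a = b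
  δ_comm : ∀ a b, δ a b = δ b a
  δ_triangle : ∀ a b c, δ a b ≤ δ a c ⊔ δ c b
  δ_graph : ∀ {n : ℕ} (f : L.Functions n) (a b : Fin n → carrier) (c d : carrier),
    alg.graph f a c → alg.graph f b d → δ c d ≤ Finset.univ.sup fun i => δ (a i) (b i)

attribute [instance] Pregamp.sup Pregamp.bot

namespace Pregamp

variable {L : FirstOrder.Language.{u, u'}}

/-- The pregamp `(A, Θ_A, Con_c A)` of an algebra `A`. -/
def ofAlgebra (L : FirstOrder.Language.{u, u'}) (A : Type w) [L.Structure A] : Pregamp.{u, u', w} L where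
  carrier := A
  alg := PartialAlg.ofAlgebra L A
  dist := Conc L A
  δ a b := Conc.principal L a b
  δ_eq_bot a b := by
    rw [← le_bot_iff, Conc.principal_le]
    exact Cong.bot_r
  δ_comm a b := eq_of_forall_ge_iff fun α => by
    rw [Conc.principal_le, Conc.principal_le]
    exact ⟨fun h => α.1.iseqv.symm h, fun h => α.1.iseqv.symm h⟩
  δ_triangle a b c := by
    rw [Conc.principal_le]
    exact Setoid.trans' _ (Conc.principal_le.1 le_sup_left) (Conc.principal_le.1 le_sup_right)
  δ_graph f a b c d hc hd := by
    rw [Conc.principal_le, ← show FirstOrder.Language.Structure.funMap f a = c from hc,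
      ← show FirstOrder.Language.Structure.funMap f b = d from hd]
    exact Cong.compat _ f a b fun i => Conc.principal_le.1
      (Finset.le_sup (f := fun i => Conc.principal L (a i) (b i)) (Finset.mem_univ i))

/-- For an ideal `I` of the semilattice of distances, the equivalence `δ(a, b) ∈ I`. -/
def setoid (M : Pregamp.{u, u', w} L) (I : Order.Ideal M.dist) : Setoid M.carrier where
  r a b := M.δ a b ∈ I
  iseqv :=
    ⟨fun a => by rw [(M.δ_eq_bot a a).2 rfl]; exact I.bot_mem,
      fun {a b} h => by rw [M.δ_comm]; exact h,
      fun {a b c} h₁ h₂ => I.lower (M.δ_triangle a c b) (Order.Ideal.sup_mem h₁ h₂)⟩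

/-- The canonical projection `A → A / I`. -/
def proj (M : Pregamp.{u, u', w} L) (I : Order.Ideal M.dist) (a : M.carrier) :
    Quotient (M.setoid I) := Quotient.mk _ a

theorem proj_eq {M : Pregamp.{u, u', w} L} {I : Order.Ideal M.dist} {a b : M.carrier} :
    M.proj I a = M.proj I b ↔ M.δ a b ∈ I := Quotient.eq (r := M.setoid I)

theorem proj_surjective (M : Pregamp.{u, u', w} L) (I : Order.Ideal M.dist) :
    Function.Surjective (M.proj I) := Quotient.mk_surjective

theorem proj_graph {M : Pregamp.{u, u', w} L} {I : Order.Ideal M.dist} {n : ℕ}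
    {f : L.Functions n} {a b : Fin n → M.carrier} {c d : M.carrier} (hc : M.alg.graph f a c)
    (hd : M.alg.graph f b d) (h : ∀ i, M.proj I (a i) = M.proj I (b i)) :
    M.proj I c = M.proj I d := by
  rw [proj_eq]
  refine I.lower (M.δ_graph f a b c d hc hd) ?_
  have : ∀ s : Finset (Fin n), (s.sup fun i => M.δ (a i) (b i)) ∈ I := fun s => by
    induction s using Finset.induction_on with
    | empty => exact I.bot_mem
    | insert i s _ ih =>
      rw [Finset.sup_insert]
      exact Order.Ideal.sup_mem (proj_eq.1 (h i)) ih
  exact this _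

theorem mk_δ_le {M : Pregamp.{u, u', w} L} {I : Order.Ideal M.dist} {a a' b b' : M.carrier}
    (ha : M.δ a a' ∈ I) (hb : M.δ b b' ∈ I) :
    SemiQuot.mk I (M.δ a b) ≤ SemiQuot.mk I (M.δ a' b') := by
  have h : M.δ a b ≤ M.δ a a' ⊔ (M.δ a' b' ⊔ M.δ b b') :=
    (M.δ_triangle a b a').trans
      (sup_le_sup_left ((M.δ_triangle a' b b').trans (by rw [M.δ_comm b' b])) _)
  refine (SemiQuot.mk_mono h).trans ?_
  rw [SemiQuot.mk_sup, SemiQuot.mk_sup, SemiQuot.mk_eq_bot.2 ha, SemiQuot.mk_eq_bot.2 hb,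
    bot_sup_eq, sup_bot_eq]

/-- The distance of `A / I`. -/
def quotδ (M : Pregamp.{u, u', w} L) (I : Order.Ideal M.dist) :
    Quotient (M.setoid I) → Quotient (M.setoid I) → SemiQuot I :=
  Quotient.map₂' (s₃ := idealSetoid I) M.δ (by
    intro a a' ha b b' hb
    refine SemiQuot.mk_eq.1 (le_antisymm (mk_δ_le ha hb) (mk_δ_le ?_ ?_))
    · exact (M.setoid I).symm' ha
    · exact (M.setoid I).symm' hb)

theorem quotδ_proj (M : Pregamp.{u, u', w} L) (I : Order.Ideal M.dist) (a b : M.carrier) :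
    M.quotδ I (M.proj I a) (M.proj I b) = SemiQuot.mk I (M.δ a b) := rfl

/-- The quotient pregamp `A / I`; `f(c)` is defined in `A / I` if and only if `c` is the image of a
tuple `a` such that `f(a)` is defined in `A`. -/
def quot (M : Pregamp.{u, u', w} L) (I : Order.Ideal M.dist) : Pregamp.{u, u', w} L where
  carrier := Quotient (M.setoid I)
  alg :=
    { graph := fun f c d => ∃ a b, M.alg.graph f a b ∧ c = (fun i => M.proj I (a i)) ∧
        d = M.proj I b
      functional := by
        rintro n f c d d' ⟨a, b, h, rfl, rfl⟩ ⟨a', b', h', e, rfl⟩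
        exact proj_graph h h' fun i => congrFun e i }
  dist := SemiQuot I
  δ := M.quotδ I
  δ_eq_bot p q := by
    obtain ⟨a, rfl⟩ := M.proj_surjective I p
    obtain ⟨b, rfl⟩ := M.proj_surjective I q
    rw [quotδ_proj, SemiQuot.mk_eq_bot, proj_eq]
  δ_comm p q := by
    obtain ⟨a, rfl⟩ := M.proj_surjective I p
    obtain ⟨b, rfl⟩ := M.proj_surjective I q
    rw [quotδ_proj, quotδ_proj, M.δ_comm]
  δ_triangle p q r := by
    obtain ⟨a, rfl⟩ := M.proj_surjective I p
    obtain ⟨b, rfl⟩ := M.proj_surjective I q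
    obtain ⟨c, rfl⟩ := M.proj_surjective I r
    rw [quotδ_proj, quotδ_proj, quotδ_proj, ← SemiQuot.mk_sup]
    exact SemiQuot.mk_mono (M.δ_triangle a b c)
  δ_graph f p q r s := by
    rintro ⟨a, c, h, rfl, rfl⟩ ⟨b, d, h', rfl, rfl⟩
    simp only [quotδ_proj]
    rw [← SemiQuot.mk_finset_sup]
    exact SemiQuot.mk_mono (M.δ_graph f a b c d h h')

/-- `M` is a pregamp of the variety `W`: for every ideal `I`, the partial algebra `A / I` satisfies
all identities of `W`. -/
def IsOf (M : Pregamp.{u, u', w} L) (W : Variety L) : Prop :=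
  ∀ (I : Order.Ideal M.dist) (s t : L.Term ℕ), W.IsIdentity s t → (M.quot I).alg.Satisfies s t

end Pregamp

/-- A gamp `(A*, A, δ, S)`: a pregamp with a partial subalgebra `A*`. -/
structure Gamp (L : FirstOrder.Language.{u, u'}) extends Pregamp.{u, u', w} L where
  star : PartialSub alg

namespace Gamp

variable {L : FirstOrder.Language.{u, u'}}

/-- The gamp `GA(A) = (A, A, Θ_A, Con_c A)` of an algebra `A`. -/
def ofAlgebra (L : FirstOrder.Language.{u, u'}) (A : Type w) [L.Structure A] : Gamp.{u, u', w} L where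
  toPregamp := Pregamp.ofAlgebra L A
  star :=
    { carrier := Set.univ
      graph := fun f a b => (PartialAlg.ofAlgebra L A).graph f a b
      mem_of_graph := fun _ => ⟨fun _ => Set.mem_univ _, Set.mem_univ _⟩
      graph_le := fun h => h }

/-- The quotient gamp `A / I = (A* / I, A / I, δ / I, S / I)`. -/
def quot (M : Gamp.{u, u', w} L) (I : Order.Ideal M.dist) : Gamp.{u, u', w} L where
  toPregamp := M.toPregamp.quot I
  star :=
    { carrier := M.proj I '' M.star.carrier
      graph := fun f c d => ∃ a b, M.star.graph f a b ∧ c = (fun i => M.proj I (a i)) ∧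
        d = M.proj I b
      mem_of_graph := by
        rintro n f c d ⟨a, b, h, rfl, rfl⟩
        exact ⟨fun i => ⟨a i, (M.star.mem_of_graph h).1 i, rfl⟩, b, (M.star.mem_of_graph h).2, rfl⟩
      graph_le := by
        rintro n f c d ⟨a, b, h, rfl, rfl⟩
        exact ⟨a, b, M.star.graph_le h, rfl, rfl⟩ }

/-- Both `A` and the semilattice of distances are finite. -/
def IsFinite (M : Gamp.{u, u', w} L) : Prop := Finite M.carrier ∧ Finite M.dist

/-- All operations are defined in `A` on tuples of `A*`. -/
def IsStrong (M : Gamp.{u, u', w} L) : Prop :=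
  ∀ {n : ℕ} (f : L.Functions n) (a : Fin n → M.carrier), (∀ i, a i ∈ M.star.carrier) →
    ∃ b, M.alg.graph f a b

/-- Every distance is a finite join of distances between elements of `A*`. -/
def IsDistanceGenerated (M : Gamp.{u, u', w} L) : Prop :=
  ∀ d : M.dist, ∃ (n : ℕ) (a b : Fin n → M.carrier),
    (∀ i, a i ∈ M.star.carrier) ∧ (∀ i, b i ∈ M.star.carrier) ∧
      d = Finset.univ.sup fun i => M.δ (a i) (b i)

/-- If `δ(a, b) ≤ ⋁ δ(aᵢ, bᵢ)` with all elements in `A*`, then there are terms `t₀, …, tₙ`, with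
`n > 0`, and parameters `z` in `A` such that `a = t₀(a⃗, b⃗, z⃗)`, `b = tₙ(a⃗, b⃗, z⃗)`, and
`tⱼ(b⃗, a⃗, z⃗) = tⱼ₊₁(a⃗, b⃗, z⃗)` for `j < n`, all these values being defined in `A`. -/
def IsCongruenceTractable (M : Gamp.{u, u', w} L) : Prop :=
  ∀ (m : ℕ) (a b : M.carrier) (as bs : Fin m → M.carrier),
    a ∈ M.star.carrier → b ∈ M.star.carrier →
    (∀ i, as i ∈ M.star.carrier) → (∀ i, bs i ∈ M.star.carrier) →
    M.δ a b ≤ (Finset.univ.sup fun i => M.δ (as i) (bs i)) →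
    ∃ (n k : ℕ) (z : Fin k → M.carrier) (t : ℕ → L.Term (Fin m ⊕ Fin m ⊕ Fin k)), 0 < n ∧
      M.alg.Eval (Sum.elim as (Sum.elim bs z)) (t 0) a ∧
      M.alg.Eval (Sum.elim as (Sum.elim bs z)) (t n) b ∧
      ∀ j < n, ∃ c, M.alg.Eval (Sum.elim bs (Sum.elim as z)) (t j) c ∧
        M.alg.Eval (Sum.elim as (Sum.elim bs z)) (t (j + 1)) c

/-- `M` has an isomorphic realization `(A', χ)` in the variety `W`: an algebra `A'` in `W` of which
`A` is a partial subalgebra (through `e`), and an isomorphism `χ` from the semilattice of distances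
onto `Con_c A'` such that `χ(δ(a, b)) = Θ_{A'}(a, b)`. -/
def HasIsomorphicRealization (M : Gamp.{u, u', w} L) (W : Variety L) : Prop :=
  ∃ (A' : Type w) (_ : L.Structure A') (e : M.carrier → A') (χ : M.dist ≃o Conc L A'),
    W.Mem A' ∧ Function.Injective e ∧
    (∀ {n : ℕ} (f : L.Functions n) (a : Fin n → M.carrier) (b : M.carrier),
      M.alg.graph f a b → FirstOrder.Language.Structure.funMap f (fun i => e (a i)) = e b) ∧
    ∀ a b, χ (M.δ a b) = Conc.principal L (e a) (e b)

/-- A morphism of gamps. -/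
structure Hom (M N : Gamp.{u, u', w} L) where
  toFun : M.carrier → N.carrier
  distHom : SupBotHom M.dist N.dist
  map_graph : ∀ {n : ℕ} (f : L.Functions n) (a : Fin n → M.carrier) (b : M.carrier),
    M.alg.graph f a b → N.alg.graph f (fun i => toFun (a i)) (toFun b)
  map_δ : ∀ a b, N.δ (toFun a) (toFun b) = distHom (M.δ a b)
  map_star : ∀ a ∈ M.star.carrier, toFun a ∈ N.star.carrier
  map_star_graph : ∀ {n : ℕ} (f : L.Functions n) (a : Fin n → M.carrier) (b : M.carrier),
    M.star.graph f a b → N.star.graph f (fun i => toFun (a i)) (toFun b)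

/-- `M` and `N` are isomorphic in the category of gamps. -/
def Isomorphic (M N : Gamp.{u, u', w} L) : Prop :=
  ∃ (g : Hom M N) (h : Hom N M),
    (∀ a, h.toFun (g.toFun a) = a) ∧ (∀ b, g.toFun (h.toFun b) = b) ∧
    (∀ d, h.distHom (g.distHom d) = d) ∧ ∀ d, g.distHom (h.distHom d) = d

/-- `N` is (isomorphic to) a quotient of `M` by an ideal. -/
def IsQuotientOf (N M : Gamp.{u, u', w} L) : Prop :=
  ∃ I : Order.Ideal M.dist, Isomorphic N (M.quot I)

namespace Hom

variable {M N : Gamp.{u, u', w} L}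

/-- The image `g(A)`, with the operations transported from `A`, is a partial subalgebra of `B*`. -/
def RangeSubStar (g : Hom M N) : Prop :=
  (∀ a, g.toFun a ∈ N.star.carrier) ∧
    ∀ {n : ℕ} (f : L.Functions n) (a : Fin n → M.carrier) (b : M.carrier),
      M.alg.graph f a b → N.star.graph f (fun i => g.toFun (a i)) (g.toFun b)

/-- `g(A)` is a strong partial subalgebra of `B*`: all operations are defined in `B*` on tuples
of `g(A)`. -/
def IsStrong (g : Hom M N) : Prop :=
  g.RangeSubStar ∧
    ∀ {n : ℕ} (f : L.Functions n) (a : Fin n → M.carrier),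
      ∃ b, N.star.graph f (fun i => g.toFun (a i)) b

/-- `g(A)` is a partial subalgebra of `B*`, and if `δ(g(a), g(b)) ≤ ⋁ X` for a finite set `X` of
distances of `B`, then `g(a)` and `g(b)` are joined by a finite sequence in `B*` each step of which
has its distance below some element of `X`. -/
def IsCongruenceCuttable (g : Hom M N) : Prop :=
  g.RangeSubStar ∧
    ∀ (X : Finset N.dist) (a b : M.carrier), N.δ (g.toFun a) (g.toFun b) ≤ X.sup id →
      ∃ (n : ℕ) (c : ℕ → N.carrier), c 0 = g.toFun a ∧ c n = g.toFun b ∧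
        (∀ k ≤ n, c k ∈ N.star.carrier) ∧ ∀ k < n, ∃ d ∈ X, N.δ (c k) (c (k + 1)) ≤ d

end Hom

end Gamp

/-! ### Diagrams indexed by a poset -/

/-- A `P`-indexed diagram of `L`-algebras. -/
structure AlgDiagram (L : FirstOrder.Language.{u, u'}) (P : Type x) [PartialOrder P] where
  obj : P → Type v
  [str : ∀ p, L.Structure (obj p)]
  map : ∀ {p q : P}, p ≤ q → obj p →[L] obj q
  map_id : ∀ (p : P) (a : obj p), map (le_refl p) a = a
  map_comp : ∀ {p q r : P} (hpq : p ≤ q) (hqr : q ≤ r) (a : obj p),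
    map hqr (map hpq a) = map (hpq.trans hqr) a

attribute [instance] AlgDiagram.str

/-- A `P`-indexed diagram of gamps. -/
structure GampDiagram (L : FirstOrder.Language.{u, u'}) (P : Type x) [PartialOrder P] where
  obj : P → Gamp.{u, u', w} L
  map : ∀ {p q : P}, p ≤ q → Gamp.Hom (obj p) (obj q)
  map_id : ∀ (p : P) (a : (obj p).carrier), (map (le_refl p)).toFun a = a
  map_id_dist : ∀ (p : P) (d : (obj p).dist), (map (le_refl p)).distHom d = d
  map_comp : ∀ {p q r : P} (hpq : p ≤ q) (hqr : q ≤ r) (a : (obj p).carrier),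
    (map hqr).toFun ((map hpq).toFun a) = (map (hpq.trans hqr)).toFun a
  map_comp_dist : ∀ {p q r : P} (hpq : p ≤ q) (hqr : q ≤ r) (d : (obj p).dist),
    (map hqr).distHom ((map hpq).distHom d) = (map (hpq.trans hqr)).distHom d

namespace GampDiagram

variable {L : FirstOrder.Language.{u, u'}} {P : Type x} [PartialOrder P]

/-- The diagram is a partial lifting in the variety `W`. -/
structure IsPartialLifting (D : GampDiagram.{u, u', w, x} L P) (W : Variety L) : Prop where
  isOf : ∀ p, (D.obj p).IsOf W
  strong : ∀ p, (D.obj p).IsStrong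
  tractable : ∀ p, (D.obj p).IsCongruenceTractable
  generated : ∀ p, (D.obj p).IsDistanceGenerated
  realization : ∀ p, (D.obj p).HasIsomorphicRealization W
  map_strong : ∀ {p q : P} (h : p < q), (D.map h.le).IsStrong
  map_cuttable : ∀ {p q : P} (h : p < q), (D.map h.le).IsCongruenceCuttable

/-- The diagram of semilattices underlying `D` is isomorphic to `Con_c ∘ A`. -/
def LiftsConc {K : FirstOrder.Language.{y, v'}} (D : GampDiagram.{u, u', w, x} L P)
    (A : AlgDiagram.{y, v', v, x} K P) : Prop :=
  ∃ e : ∀ p, (D.obj p).dist ≃o Conc K (A.obj p),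
    ∀ {p q : P} (h : p ≤ q) (d : (D.obj p).dist),
      e q ((D.map h).distHom d) = Conc.map (A.map h) (e p d)

end GampDiagram

/-! ### Norm-coverings, lifters and condensates -/

section Lifters

variable {X : Type y} [PartialOrder X] {P : Type x} [PartialOrder P]

/-- A finite subset `V` of `X` is a kernel if below each `u` there is a largest element of `V`. -/
def IsKernel (V : Finset X) : Prop := ∀ u : X, ∃ v, IsGreatest {v | v ∈ V ∧ v ≤ u} v

/-- `X` is supported if every finite subset is contained in a kernel. -/
def IsSupported (X : Type y) [PartialOrder X] : Prop :=
  ∀ s : Finset X, ∃ V : Finset X, s ⊆ V ∧ IsKernel V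

/-- For an isotone map `∂ : X → P`, `IsNorm ∂ I p` says that the ideal `I` of `X` is sharp with
`∂I = p`, that is, `p` is the largest element of `{∂u | u ∈ I}`. -/
def IsNorm (nm : X →o P) (I : Order.Ideal X) (p : P) : Prop :=
  IsGreatest {q | ∃ a ∈ I, nm a = q} p

/-- The pair of `X`, with norm `nm : X → P`, and of the set `Y` of ideals of `X` is an
`ℵ₀`-lifter of `P`. -/
structure IsLifter (nm : X →o P) (Y : Set (Order.Ideal X)) : Prop where
  /-- `X`, with the norm `nm`, is a norm-covering of `P`. -/
  supported : IsSupported X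
  /-- All members of `Y` are sharp. -/
  sharp : ∀ I ∈ Y, ∃ p, IsNorm nm I p
  /-- The set of members of `Y` of non-maximal norm is lower finite. -/
  lower_finite : ∀ I ∈ Y, ∀ p, IsNorm nm I p → ¬ IsMax p → {J ∈ Y | J ≤ I}.Finite
  /-- The values of `S` that matter are those at the members of `Y` of non-maximal norm. -/
  exists_section : ∀ S : Order.Ideal X → Finset X, ∃ σ : P →o Order.Ideal X,
    (∀ p, σ p ∈ Y ∧ IsNorm nm (σ p) p) ∧
    ∀ p q : P, p < q → ∀ a ∈ S (σ p), a ∈ σ q → a ∈ σ p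

end Lifters

section Condensate

variable {L : FirstOrder.Language.{u, u'}}

/-- The product of a family of algebras. -/
instance piStructure [L.IsAlgebraic] {ι : Type y} (A : ι → Type v) [∀ i, L.Structure (A i)] :
    L.Structure (∀ i, A i) where
  funMap f a := fun i => FirstOrder.Language.Structure.funMap f fun k => a k i
  RelMap r := isEmptyElim r

variable {X : Type y} [PartialOrder X] {P : Type x} [PartialOrder P]

/-- The subset `V` is a support of `a ∈ ∏_{u ∈ X} A_{∂u}`: for all `u`, if `v` is the largest
element of `V` below `u`, then `a_u` is the image of `a_v`. -/
def IsSupport (A : AlgDiagram.{u, u', v, x} L P) (nm : X →o P) (V : Finset X)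
    (a : ∀ u : X, A.obj (nm u)) : Prop :=
  ∀ u v : X, ∀ h : IsGreatest {v | v ∈ V ∧ v ≤ u} v, a u = A.map (nm.monotone h.1.2) (a v)

theorem IsSupport.mono {A : AlgDiagram.{u, u', v, x} L P} {nm : X →o P} {V V' : Finset X}
    {a : ∀ u : X, A.obj (nm u)} (hV : IsKernel V) (h : IsSupport A nm V a) (hVV' : V ⊆ V') :
    IsSupport A nm V' a := by
  intro p q hq
  obtain ⟨c, hc⟩ := hV p
  have hcq : c ≤ q := hq.2 ⟨hVV' hc.1.1, hc.1.2⟩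
  have hc' : IsGreatest {v | v ∈ V ∧ v ≤ q} c :=
    ⟨⟨hc.1.1, hcq⟩, fun d hd => hc.2 ⟨hd.1, hd.2.trans hq.1.2⟩⟩
  rw [h p c hc, h q c hc', A.map_comp]

/-- The condensate `F(X) ⊗ A`: the subalgebra of `∏_{u ∈ X} A_{∂u}` of all elements that have a
kernel as a support. For a kernel `V`, the elements with support `V` form a copy of the finite
product `∏_{v ∈ V} A_{∂v}`; so this is the directed union over all kernels `V`, that is, the
directed colimit, of these finite products, where for kernels `V ⊆ V'` the map from
`∏_{v ∈ V} A_{∂v}` to `∏_{v ∈ V'} A_{∂v}` sends `a` to the family of the images of the `a_w`,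
with `w` the largest element of `V` below `v`. -/
def condensate [L.IsAlgebraic] (A : AlgDiagram.{u, u', v, x} L P) (nm : X →o P)
    (hX : IsSupported X) : L.Substructure (∀ u : X, A.obj (nm u)) where
  carrier := {a | ∃ V : Finset X, IsKernel V ∧ IsSupport A nm V a}
  fun_mem {n} f a ha := by
    classical
    choose V hV hs using ha
    obtain ⟨K, hK, hK'⟩ := hX (Finset.univ.biUnion V)
    refine ⟨K, hK', fun p q h => ?_⟩
    have key : ∀ i, a i p = A.map (nm.monotone h.1.2) (a i q) := fun i =>
      (hs i).mono (hV i)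
        ((Finset.subset_biUnion_of_mem V (Finset.mem_univ i)).trans hK) p q h
    change FirstOrder.Language.Structure.funMap f (fun k => a k p) =
      A.map _ (FirstOrder.Language.Structure.funMap f fun k => a k q)
    rw [FirstOrder.Language.Hom.map_fun]
    congr 1
    funext i
    exact key i

/-- The elements with support a kernel `V` correspond to those of the product over `V`. -/
theorem IsKernel.existsUnique_extension {V : Finset X} (hV : IsKernel V)
    (A : AlgDiagram.{u, u', v, x} L P) (nm : X →o P) (b : ∀ v : X, v ∈ V → A.obj (nm v)) :
    ∃! a : ∀ u : X, A.obj (nm u), IsSupport A nm V a ∧ ∀ v hv, a v = b v hv := by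
  choose g hg using hV
  have hgv : ∀ p q, IsGreatest {v | v ∈ V ∧ v ≤ p} q → q = g p := fun p q h => h.unique (hg p)
  have self : ∀ (q : X) (hq : q ∈ V),
      A.map (nm.monotone (hg q).1.2) (b (g q) (hg q).1.1) = b q hq := by
    intro q hq
    have e : q = g q := hgv q q ⟨⟨hq, le_rfl⟩, fun d hd => hd.2⟩
    have gen : ∀ (r : X) (hr : r ∈ V) (hle : r ≤ q), r = q →
        A.map (nm.monotone hle) (b r hr) = b q hq := by
      rintro r hr hle rfl
      exact A.map_id _ _
    exact gen _ _ (hg q).1.2 e.symm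
  refine ⟨fun p => A.map (nm.monotone (hg p).1.2) (b (g p) (hg p).1.1), ⟨?_, self⟩, ?_⟩
  · intro p q h
    obtain rfl := hgv p q h
    exact congrArg _ (self _ (hg p).1.1).symm
  · rintro a ⟨ha, hb⟩
    funext p
    rw [ha p (g p) (hg p), hb _ (hg p).1.1]

end Condensate

end CLLGamp

open CLLGamp

universe u₁ u₂ u₃ u₄ u₅ u₆ u₇ u₈

namespace CLLGamp

open FirstOrder FirstOrder.Language

universe u u' v v' w x y

/-! ### Identities in arbitrary universes -/

section Identities

variable {L : FirstOrder.Language.{u, u'}}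

/-! Every sharp ideal `I` of `X` of norm `p` gives a surjective homomorphism from the condensate
onto `A_p` (`condensate.proj_surjective`). Applying `Con_c` and composing with the isomorphism from
`Con_c B`, one gets a (∨,0)-homomorphism from `Con_c B` onto `Con_c A_p` that is, up to isomorphism,
the quotient by its kernel (`Conc.map_isIdealInduced`). If `θ_I` is the congruence of `B` given by
this kernel, then `Con_c (B / θ_I)` is isomorphic to `Con_c A_p` (`exists_orderIso_conc_quo`). The
quotients `B / θ_I` thus lift the objects of the diagram but not its arrows: for `I ⊆ J` nothing
forces `θ_I ⊆ θ_J`.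

The remedy is to keep only finitely many elements of `B`. If `p` is not maximal, then `Con_c A_p` is
finite, and so is the similarity type; hence there are finite sets `C₀ ⊆ C` in `B` whose images in
`B / θ_I` form a gamp with the required properties (`exists_finite_isStage`). Tractability is
witnessed by Mal'cev chains (`exists_malcevChain`). The ideals of non-maximal norm form a lower
finite set, so these sets can be chosen recursively, each one over those of all smaller ideals
(`exists_isStage_tower`); this makes the inclusions strong and congruence-cuttable. At maximal `p`
all of `B` is kept.

A compact congruence of the condensate depends on finitely many elements of `X` only
(`condensate.exists_conc_support`). Let `S(I)` collect these elements for the congruences that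
correspond to `Θ_B(a, b)`, with `a, b` in the finite set chosen for `I`. The lifter provides `σ`
with `S(σ p) ∩ σ q ⊆ σ p`. Hence on the set chosen for `σ p` the distances modulo `θ_{σ q}` are the
images, under `Con_c` of the map from `A_p` to `A_q`, of those modulo `θ_{σ p}`. So inclusions of
subsets of `B` do induce the missing arrows (`exists_partialLifting_of_stages`). -/

theorem Variety.Mem.of_injective {W : Variety L} {A : Type v} [L.Structure A] (h : W.Mem A)
    {B : Type v'} [L.Structure B] [Nonempty B] (f : B →[L] A) (hf : Function.Injective f) :
    W.Mem B :=
  ⟨inferInstance, fun e he a => hf (by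
    rw [← HomClass.realize_term f, ← HomClass.realize_term f]
    exact h.2 e he _)⟩

theorem Variety.Mem.of_surjective {W : Variety L} {A : Type v} [L.Structure A] (h : W.Mem A)
    {B : Type v'} [L.Structure B] (f : A →[L] B) (hf : Function.Surjective f) :
    W.Mem B := by
  refine ⟨h.1.map f, fun e he a => ?_⟩
  choose g hg using hf
  have ha : a = f ∘ fun n => g (a n) := funext fun n => (hg _).symm
  rw [ha, HomClass.realize_term f, HomClass.realize_term f, h.2 e he]

/-- The identities of a variety hold in its members in all universes. -/
theorem Variety.IsIdentity.realize_eq {W : Variety L} {s t : L.Term ℕ} (hst : W.IsIdentity s t)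
    {A : Type v} [L.Structure A] (hA : W.Mem A) (a : ℕ → A) : s.realize a = t.realize a := by
  -- `IsIdentity` speaks of algebras in one universe only. The subalgebra generated by the countably
  -- many values of `a` is small, so it has a copy there.
  let S := Substructure.closure L (Set.range a)
  have : Small.{u} (Set.range a) :=
    have := (Set.countable_range a).to_subtype
    inferInstance
  have : Small.{u} S := Substructure.small_closure
  let _ : L.Structure (Shrink.{u} S) := (equivShrink S).inducedStructure
  let e : S ≃[L] Shrink.{u} S := (equivShrink S).inducedStructureEquiv
  let f : Shrink.{u} S →[L] A := S.subtype.toHom.comp e.symm.toHom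
  let b : ℕ → Shrink.{u} S := fun n => e ⟨a n, Substructure.subset_closure ⟨n, rfl⟩⟩
  have hb : f ∘ b = a := by
    funext n
    change (S.subtype (e.symm (e _))) = a n
    rw [Language.Equiv.symm_apply_apply]
    rfl
  have hf : Function.Injective f := fun x y h =>
    e.symm.injective (S.subtype.injective h)
  have : Nonempty (Shrink.{u} S) := ⟨b 0⟩
  rw [← hb, HomClass.realize_term f, HomClass.realize_term f, hst _ (hA.of_injective f hf)]

end Identities

/-! ### Quotient algebras -/

section Quotients

variable {L : FirstOrder.Language.{u, u'}} {A : Type v} [L.Structure A]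

/-- The underlying set of the quotient algebra `A / θ`. -/
def Cong.Quo (θ : Cong L A) : Type v := Quotient θ.toSetoid

namespace Cong

variable (θ : Cong L A)

theorem refl (a : A) : θ.r a a := θ.iseqv.refl a

variable {θ} in
theorem symm {a b : A} (h : θ.r a b) : θ.r b a := θ.iseqv.symm h

variable {θ} in
theorem trans {a b c : A} (h : θ.r a b) (h' : θ.r b c) : θ.r a c := θ.iseqv.trans h h'

variable [L.IsAlgebraic]

noncomputable instance : L.Structure θ.Quo where
  funMap f a := Quotient.mk θ.toSetoid (Structure.funMap f fun i => (a i).out)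
  RelMap r := isEmptyElim r

/-- The canonical projection onto the quotient algebra. -/
noncomputable def proj : A →[L] θ.Quo where
  toFun := Quotient.mk θ.toSetoid
  map_fun' f a := Quotient.sound (s := θ.toSetoid)
    (θ.compat f _ _ fun _ => Cong.symm (Quotient.mk_out (s := θ.toSetoid) _))
  map_rel' r := isEmptyElim r

theorem proj_surjective : Function.Surjective θ.proj := Quotient.mk_surjective

variable {θ} in
theorem proj_eq {a b : A} : θ.proj a = θ.proj b ↔ θ.r a b := Quotient.eq (r := θ.toSetoid)

end Cong

end Quotients

/-! ### Homomorphisms induced by ideals -/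

section IdealInduced

/-- A `(∨, 0)`-homomorphism that induces an isomorphism from the quotient of its domain by its
kernel onto its codomain. -/
structure IsIdealInduced {S : Type v} [SemilatticeSup S] [OrderBot S] {T : Type w}
    [SemilatticeSup T] [OrderBot T] (h : SupBotHom S T) : Prop where
  surjective : Function.Surjective h
  exists_le : ∀ a b, h a ≤ h b → ∃ c, h c = ⊥ ∧ a ≤ b ⊔ c

namespace IsIdealInduced

variable {S : Type v} [SemilatticeSup S] [OrderBot S] {T : Type w} [SemilatticeSup T] [OrderBot T]

/-- The order of the codomain can be read off in the domain: `h a ≤ h b` means that `a ≤ b ⊔ c` for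
some `c` killed by `h`. So it depends on the kernel only. -/
theorem exists_orderIso {U : Type y} [SemilatticeSup U] [OrderBot U] {h : SupBotHom S T}
    (hh : IsIdealInduced h) {h' : SupBotHom S U} (hh' : IsIdealInduced h')
    (hker : ∀ c, h c = ⊥ ↔ h' c = ⊥) : ∃ e : T ≃o U, ∀ a, e (h a) = h' a := by
  have key : ∀ a b, h a ≤ h b ↔ h' a ≤ h' b := fun a b =>
    ⟨fun hab => by
      obtain ⟨c, hc, hle⟩ := hh.exists_le a b hab
      have := OrderHomClass.mono h' hle
      rwa [map_sup, (hker c).1 hc, sup_bot_eq] at this,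
    fun hab => by
      obtain ⟨c, hc, hle⟩ := hh'.exists_le a b hab
      have := OrderHomClass.mono h hle
      rwa [map_sup, (hker c).2 hc, sup_bot_eq] at this⟩
  choose g hg using hh.surjective
  choose g' hg' using hh'.surjective
  have e1 : ∀ a, h' (g (h a)) = h' a := fun a =>
    le_antisymm ((key _ _).1 (hg _).le) ((key _ _).1 (hg _).ge)
  have e2 : ∀ a, h (g' (h' a)) = h a := fun a =>
    le_antisymm ((key _ _).2 (hg' _).le) ((key _ _).2 (hg' _).ge)
  refine ⟨{ toFun := fun t => h' (g t), invFun := fun t => h (g' t),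
            left_inv := fun t => (e2 (g t)).trans (hg t), right_inv := fun t => (e1 (g' t)).trans (hg' t),
            map_rel_iff' := ?_ }, e1⟩
  intro s t
  change h' (g s) ≤ h' (g t) ↔ _
  rw [← key, hg, hg]

end IsIdealInduced

end IdealInduced

/-! ### Ideals of `Con_c A`, and `Con_c` of a surjective homomorphism -/

section ConcMap

variable {L : FirstOrder.Language.{u, u'}} {A : Type v} [L.Structure A] {B : Type v'} [L.Structure B]

theorem Conc.map_principal (f : A →[L] B) (a b : A) :
    Conc.map f (Conc.principal L a b) = Conc.principal L (f a) (f b) :=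
  Subtype.ext (Cong.map_principal f a b)

theorem Conc.exists_eq_sup (α : Conc L A) :
    ∃ s : Finset (A × A), α = s.sup fun e => Conc.principal L e.1 e.2 := by
  classical
  obtain ⟨α, s, rfl⟩ := α
  refine ⟨s, Subtype.ext ?_⟩
  induction s using Finset.induction_on with
  | empty => rfl
  | insert e s _ ih =>
    change (insert e s).sup _ = _
    rw [Finset.sup_insert, Finset.sup_insert]
    exact congrArg (Cong.principal L e.1 e.2 ⊔ ·) ih

theorem Conc.principal_eq_bot {a b : A} : Conc.principal L a b = ⊥ ↔ a = b :=
  (Pregamp.ofAlgebra L A).δ_eq_bot a b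

theorem Conc.principal_proj_eq_bot [L.IsAlgebraic] {θ : Cong L A} {a b : A} :
    Conc.principal L (θ.proj a) (θ.proj b) = ⊥ ↔ θ.r a b := by
  rw [Conc.principal_eq_bot, Cong.proj_eq]

theorem Conc.map_surjective {f : A →[L] B} (hf : Function.Surjective f) :
    Function.Surjective (Conc.map f) := by
  intro β
  obtain ⟨s, rfl⟩ := β.exists_eq_sup
  choose g hg using hf
  refine ⟨s.sup fun e => Conc.principal L (g e.1) (g e.2), ?_⟩
  rw [map_finset_sup]
  refine Finset.sup_congr rfl fun e _ => ?_
  simp only [Function.comp, Conc.map_principal, hg]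

/-- The congruence of all pairs whose principal congruence is in the ideal `I`. -/
def Cong.ofIdeal (I : Order.Ideal (Conc L A)) : Cong L A where
  toSetoid := (Pregamp.ofAlgebra L A).setoid I
  compat f a b h := Pregamp.proj_eq.1 (Pregamp.proj_graph (M := Pregamp.ofAlgebra L A) (I := I)
    (f := f) (a := a) (b := b) rfl rfl fun i => Pregamp.proj_eq.2 (h i))

theorem Cong.ofIdeal_r {I : Order.Ideal (Conc L A)} {a b : A} :
    (Cong.ofIdeal I).r a b ↔ Conc.principal L a b ∈ I := Iff.rfl

theorem Ideal.finset_sup_mem {S : Type v} [SemilatticeSup S] [OrderBot S] {I : Order.Ideal S}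
    {ι : Type w} (s : Finset ι) (f : ι → S) (h : ∀ i ∈ s, f i ∈ I) : s.sup f ∈ I :=
  Finset.sup_induction I.bot_mem (fun _ ha _ hb => Order.Ideal.sup_mem ha hb) h

/-- A compact congruence is a finite join of principal ones, and an ideal is closed under finite
joins; so an ideal of `Con_c A` can be recovered from its congruence. -/
theorem Cong.le_ofIdeal {I : Order.Ideal (Conc L A)} {α : Conc L A} :
    α.1 ≤ Cong.ofIdeal I ↔ α ∈ I := by
  constructor
  · intro h
    obtain ⟨s, rfl⟩ := α.exists_eq_sup
    refine Ideal.finset_sup_mem _ _ fun e he => Cong.ofIdeal_r.1 (h _ _ ?_)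
    exact Conc.principal_le.1 (Finset.le_sup (f := fun e : A × A => Conc.principal L e.1 e.2) he)
  · intro h a b hab
    exact I.lower (Conc.principal_le.2 hab) h

/-- The kernel of a `(∨, 0)`-homomorphism. -/
def kerIdeal {S : Type v} [SemilatticeSup S] [OrderBot S] {T : Type w} [SemilatticeSup T]
    [OrderBot T] (h : SupBotHom S T) : Order.Ideal S where
  carrier := {a | h a = ⊥}
  lower' a b hab ha := le_bot_iff.1 ((OrderHomClass.mono h hab).trans (le_of_eq ha))
  nonempty' := ⟨⊥, map_bot h⟩
  directed' a ha b hb := ⟨a ⊔ b, by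
    change h (a ⊔ b) = ⊥
    rw [map_sup, show h a = ⊥ from ha, show h b = ⊥ from hb, sup_bot_eq], le_sup_left, le_sup_right⟩

theorem mem_kerIdeal {S : Type v} [SemilatticeSup S] [OrderBot S] {T : Type w} [SemilatticeSup T]
    [OrderBot T] {h : SupBotHom S T} {a : S} : a ∈ kerIdeal h ↔ h a = ⊥ := Iff.rfl

/-- Consider the ideal of all compact congruences below some `β ⊔ γ` with `γ` killed by `f`. Its
congruence contains the kernel of `f`, so its image under `f` is a congruence of `B`. The image
contains `map f β`, hence `map f α`, and pulling back puts `α` in the ideal. -/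
theorem Conc.map_isIdealInduced {f : A →[L] B} (hf : Function.Surjective f) :
    IsIdealInduced (Conc.map f) where
  surjective := Conc.map_surjective hf
  exists_le α β hαβ := by
    let I : Order.Ideal (Conc L A) :=
      { carrier := {δ | ∃ γ, Conc.map f γ = ⊥ ∧ δ ≤ β ⊔ γ}
        lower' := fun a b hab ⟨γ, h, h'⟩ => ⟨γ, h, hab.trans h'⟩
        nonempty' := ⟨⊥, ⊥, map_bot _, bot_le⟩
        directed' := by
          rintro a ⟨γ, h, h'⟩ b ⟨γ', k, k'⟩
          refine ⟨a ⊔ b, ⟨γ ⊔ γ', by rw [map_sup, h, k, sup_bot_eq], ?_⟩, le_sup_left, le_sup_right⟩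
          exact sup_le (h'.trans (sup_le_sup_left le_sup_left _))
            (k'.trans (sup_le_sup_left le_sup_right _)) }
    have hker : ∀ a b, f a = f b → (Cong.ofIdeal I).r a b := fun a b hab =>
      ⟨Conc.principal L a b, by rw [Conc.map_principal, Conc.principal_eq_bot, hab], le_sup_right⟩
    let θ : Cong L B :=
      { r := fun p q => ∃ a b, f a = p ∧ f b = q ∧ (Cong.ofIdeal I).r a b
        iseqv := by
          refine ⟨fun p => ?_, ?_, ?_⟩
          · obtain ⟨a, rfl⟩ := hf p
            exact ⟨a, a, rfl, rfl, (Cong.ofIdeal I).iseqv.refl a⟩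
          · rintro p q ⟨a, b, rfl, rfl, h⟩
            exact ⟨b, a, rfl, rfl, (Cong.ofIdeal I).iseqv.symm h⟩
          · rintro p q r ⟨a, b, rfl, rfl, h⟩ ⟨b', c, hb, rfl, h'⟩
            exact ⟨a, c, rfl, rfl, (Cong.ofIdeal I).iseqv.trans h
              ((Cong.ofIdeal I).iseqv.trans (hker _ _ hb.symm) h')⟩
        compat := by
          intro n g p q h
          choose a b ha hb hab using h
          obtain rfl := funext ha
          obtain rfl := funext hb
          exact ⟨_, _, f.map_fun g a, f.map_fun g b, (Cong.ofIdeal I).compat g a b hab⟩ }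
    have hβ : Cong.map f β.1 ≤ θ := (Cong.gc f _ _).2 fun a b hab =>
      ⟨a, b, rfl, rfl, ⊥, map_bot _, (Conc.principal_le.2 hab).trans le_sup_left⟩
    refine (Cong.le_ofIdeal (I := I)).1 fun a b hab => ?_
    obtain ⟨a', b', ha, hb, h⟩ := hβ _ _ (hαβ _ _ (((Cong.gc f) _ _).1 le_rfl a b hab))
    exact (Cong.ofIdeal I).iseqv.trans (hker _ _ ha.symm)
      ((Cong.ofIdeal I).iseqv.trans h (hker _ _ hb))

theorem SemiQuot.mk_isIdealInduced {S : Type v} [SemilatticeSup S] [OrderBot S]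
    (I : Order.Ideal S) :
    IsIdealInduced
      ({ toFun := SemiQuot.mk I, map_sup' := SemiQuot.mk_sup, map_bot' := SemiQuot.mk_bot } :
        SupBotHom S (SemiQuot I)) where
  surjective := SemiQuot.mk_surjective I
  exists_le a b h := by
    have h : SemiQuot.mk I a ≤ SemiQuot.mk I b := h
    rw [← sup_eq_right, ← SemiQuot.mk_sup, SemiQuot.mk_eq] at h
    obtain ⟨c, hc, h⟩ := h
    exact ⟨c, SemiQuot.mk_eq_bot.2 hc, (le_sup_left.trans le_sup_left).trans h.le⟩

end ConcMap

end CLLGamp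

namespace CLLGamp

open FirstOrder FirstOrder.Language Filter

universe u u' v x y

/-! ### Projections of a condensate -/

section Projections

variable {L : FirstOrder.Language.{u, u'}}
  {X : Type y} [PartialOrder X] {P : Type x} [PartialOrder P]

instance Ideal.isDirectedOrder (I : Order.Ideal X) : IsDirectedOrder I :=
  ⟨fun a b => by
    obtain ⟨c, hc, hac, hbc⟩ := I.directed a.1 a.2 b.1 b.2
    exact ⟨⟨c, hc⟩, hac, hbc⟩⟩

instance Ideal.nonempty_coe (I : Order.Ideal X) : Nonempty I :=
  I.nonempty.to_subtype

/-- The finite set `V ∩ I` has an upper bound `u` in the directed set `I`; the largest element of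
`V` below `u` is then the one sought. -/
theorem IsKernel.exists_isGreatest_ideal {V : Finset X} (hV : IsKernel V) (I : Order.Ideal X) :
    ∃ v, IsGreatest {v | v ∈ V ∧ v ∈ I} v := by
  classical
  obtain ⟨⟨u, hu⟩, h⟩ : ∃ u : I, ∀ w ∈ V.subtype (· ∈ I), w ≤ u :=
    (V.subtype (· ∈ I)).exists_le
  obtain ⟨v, hv⟩ := hV u
  refine ⟨v, ⟨hv.1.1, I.lower hv.1.2 hu⟩, fun w hw => hv.2 ⟨hw.1, ?_⟩⟩
  exact h ⟨w, hw.2⟩ (Finset.mem_subtype.2 hw.1)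

theorem IsNorm.norm_le {nm : X →o P} {I : Order.Ideal X} {p : P} (h : IsNorm nm I p) {u : X}
    (hu : u ∈ I) : nm u ≤ p := h.2 ⟨u, hu, rfl⟩

theorem IsNorm.unique {nm : X →o P} {I : Order.Ideal X} {p q : P} (h : IsNorm nm I p)
    (h' : IsNorm nm I q) : p = q := IsGreatest.unique h h'

variable [L.IsAlgebraic] (A : AlgDiagram.{u, u', v, x} L P) {nm : X →o P} (hX : IsSupported X)
  {I : Order.Ideal X} {p : P} (hI : IsNorm nm I p)

omit [L.IsAlgebraic] in
variable {A hX} in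
-- For every `w` in `I` above `v`, the largest element of `V` below `w` is `v` itself. The images in
-- `A_p` therefore stabilize, which permits defining the projection as an eventual value, with no
-- choice of a kernel.
theorem condensate.eventually_eq {a : ∀ u : X, A.obj (nm u)} {V : Finset X}
    (hs : IsSupport A nm V a) {v : X} (hv : IsGreatest {v | v ∈ V ∧ v ∈ I} v) :
    ∀ᶠ w : I in atTop, A.map (hI.norm_le w.2) (a w) = A.map (hI.norm_le hv.1.2) (a v) := by
  filter_upwards [eventually_ge_atTop (⟨v, hv.1.2⟩ : I)] with w hw
  have : IsGreatest {v | v ∈ V ∧ v ≤ w.1} v :=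
    ⟨⟨hv.1.1, hw⟩, fun d hd => hv.2 ⟨hd.1, I.lower hd.2 w.2⟩⟩
  rw [hs w.1 v this, A.map_comp]

theorem condensate.exists_eventually_eq (a : condensate A nm hX) :
    ∃ c, ∀ᶠ w : I in atTop, A.map (hI.norm_le w.2) (a.1 w) = c := by
  obtain ⟨V, hV, hs⟩ := a.2
  obtain ⟨v, hv⟩ := hV.exists_isGreatest_ideal I
  exact ⟨_, condensate.eventually_eq hI hs hv⟩

/-- The projection of the condensate to `A_{∂I}`, for a sharp ideal `I` of `X`. -/
noncomputable def condensate.proj : condensate A nm hX →[L] A.obj p where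
  toFun a := (condensate.exists_eventually_eq A hX hI a).choose
  map_fun' {n} f a := by
    have h := (condensate.exists_eventually_eq A hX hI (Structure.funMap f a)).choose_spec
    have h' := eventually_all.2 fun i =>
      (condensate.exists_eventually_eq A hX hI (a i)).choose_spec
    -- At a single `w` far enough in `I` all the eventual values are attained, and there the
    -- operation is computed coordinatewise.
    obtain ⟨w, hw, hw'⟩ := (h.and h').exists
    refine hw.symm.trans ?_
    refine Eq.trans ?_ (congrArg (Structure.funMap f) (funext hw'))
    exact (A.map (hI.norm_le w.2)).map_fun f fun i => (a i).1 w.1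
  map_rel' r := isEmptyElim r

variable {A hX}

theorem condensate.proj_eq {a : condensate A nm hX} {c : A.obj p}
    (h : ∀ᶠ w : I in atTop, A.map (hI.norm_le w.2) (a.1 w) = c) :
    condensate.proj A hX hI a = c := by
  obtain ⟨w, hw, hw'⟩ :=
    ((condensate.exists_eventually_eq A hX hI a).choose_spec.and h).exists
  exact hw.symm.trans hw'

theorem condensate.proj_surjective (hA : ∀ p, Nonempty (A.obj p)) :
    Function.Surjective (condensate.proj A hX hI) := by
  classical
  intro c
  obtain ⟨u, hu, rfl⟩ := hI.1
  obtain ⟨V, huV, hV⟩ := hX {u}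
  obtain ⟨v, hv⟩ := hV.exists_isGreatest_ideal I
  have huv : u ≤ v := hv.2 ⟨huV (Finset.mem_singleton_self u), hu⟩
  -- Only the entry at `v` matters, and `u ≤ v`. Where `c` has no image the entry is arbitrary,
  -- which is why all the algebras must be nonempty.
  obtain ⟨a, ⟨ha, hb⟩, -⟩ := hV.existsUnique_extension A nm fun w _ =>
    if h : nm u ≤ nm w then A.map h c else (hA _).some
  refine ⟨⟨a, V, hV, ha⟩, condensate.proj_eq hI ?_⟩
  filter_upwards [condensate.eventually_eq hI ha hv] with w hw
  rw [hw, hb v hv.1.1, dif_pos (nm.monotone huv), A.map_comp, A.map_id]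

/-- If `V ∩ J ⊆ I`, then the largest element of `V` in `I` is also the largest one in `J`, and both
projections are computed from the entry at it. -/
theorem condensate.proj_eq_map {J : Order.Ideal X} {q : P} (hJ : IsNorm nm J q) (hIJ : I ≤ J)
    (hpq : p ≤ q) {a : condensate A nm hX} {V : Finset X} (hV : IsKernel V)
    (hs : IsSupport A nm V a.1) (hVI : ∀ v ∈ V, v ∈ J → v ∈ I) :
    condensate.proj A hX hJ a = A.map hpq (condensate.proj A hX hI a) := by
  obtain ⟨v, hv⟩ := hV.exists_isGreatest_ideal I
  have hv' : IsGreatest {v | v ∈ V ∧ v ∈ J} v :=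
    ⟨⟨hv.1.1, hIJ hv.1.2⟩, fun w hw => hv.2 ⟨hw.1, hVI w hw.1 hw.2⟩⟩
  rw [condensate.proj_eq hJ (condensate.eventually_eq hJ hs hv'),
    condensate.proj_eq hI (condensate.eventually_eq hI hs hv), A.map_comp]

variable (A hX) in
/-- A finite subset of `X` that contains supports of generators of a compact congruence. -/
theorem condensate.exists_conc_support (α : Conc L (condensate A nm hX)) :
    ∃ S : Finset X, ∀ (I J : Order.Ideal X) (p q : P) (hI : IsNorm nm I p) (hJ : IsNorm nm J q)
      (_ : I ≤ J) (hpq : p ≤ q), (∀ v ∈ S, v ∈ J → v ∈ I) →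
      Conc.map (condensate.proj A hX hJ) α =
        Conc.map (A.map hpq) (Conc.map (condensate.proj A hX hI) α) := by
  classical
  obtain ⟨s, rfl⟩ := α.exists_eq_sup
  choose V hV hs using fun a : condensate A nm hX => a.2
  refine ⟨s.biUnion fun e => V e.1 ∪ V e.2, fun I J p q hI hJ hIJ hpq h => ?_⟩
  simp only [map_finset_sup, Function.comp_def, Conc.map_principal]
  refine Finset.sup_congr rfl fun e he => ?_
  rw [condensate.proj_eq_map hI hJ hIJ hpq (hV e.1) (hs e.1),
    condensate.proj_eq_map hI hJ hIJ hpq (hV e.2) (hs e.2)]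
  · exact fun v hv => h v (Finset.mem_biUnion.2 ⟨e, he, Finset.mem_union_right _ hv⟩)
  · exact fun v hv => h v (Finset.mem_biUnion.2 ⟨e, he, Finset.mem_union_left _ hv⟩)

end Projections

end CLLGamp

namespace CLLGamp

open FirstOrder FirstOrder.Language

universe u u' v w

/-! ### Congruences as transitive closures of translation-invariant relations -/

section Chains

variable {L : FirstOrder.Language.{u, u'}} {A : Type v} [L.Structure A]

/-- The reflexive transitive closure of a symmetric relation that is preserved by all unary
translations is a congruence. -/
def Cong.ofTranslations (r : A → A → Prop) (hr : ∀ a b, r a b → r b a)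
    (h : ∀ {n : ℕ} (f : L.Functions n) (a : Fin n → A) (i : Fin n) (x y : A), r x y →
      r (Structure.funMap f (Function.update a i x)) (Structure.funMap f (Function.update a i y))) :
    Cong L A where
  r := Relation.ReflTransGen r
  iseqv := ⟨fun _ => .refl, fun h =>
    @Std.Symm.symm _ _ (@Relation.ReflTransGen.stdSymm _ _ ⟨hr⟩) _ _ h, fun h h' => h.trans h'⟩
  compat {n} f a b hab := by
    -- The arguments are changed one at a time; `s` is the set of coordinates already changed.
    have key : ∀ s : Finset (Fin n), Relation.ReflTransGen r (Structure.funMap f a)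
        (Structure.funMap f (s.piecewise b a)) := by
      intro s
      induction s using Finset.induction_on with
      | empty => rw [Finset.piecewise_empty]
      | insert i s hi ih =>
        refine ih.trans ?_
        have e : s.piecewise b a = Function.update (s.piecewise b a) i (a i) := by
          rw [← Finset.piecewise_eq_of_notMem s b a hi, Function.update_eq_self]
        rw [Finset.piecewise_insert]
        conv_lhs => rw [e]
        exact (hab i).lift (fun x => Structure.funMap f (Function.update (s.piecewise b a) i x))
          fun x y hxy => h f _ i x y hxy
    simpa using key Finset.univ

theorem Relation.ReflTransGen.exists_seq {r : A → A → Prop} {a b : A}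
    (h : Relation.ReflTransGen r a b) :
    ∃ (n : ℕ) (c : ℕ → A), c 0 = a ∧ c n = b ∧ ∀ k < n, r (c k) (c (k + 1)) := by
  induction h using Relation.ReflTransGen.head_induction_on with
  | refl => exact ⟨0, fun _ => b, rfl, rfl, fun k hk => absurd hk (Nat.not_lt_zero k)⟩
  | head h _ ih =>
    rename_i x y _
    obtain ⟨n, c, h0, hn, hc⟩ := ih
    refine ⟨n + 1, fun k => Nat.casesOn (motive := fun _ => A) k x c, rfl, hn, fun k hk => ?_⟩
    cases k with
    | zero =>
      change r x (c 0)
      rwa [h0]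
    | succ k => exact hc k (Nat.lt_of_succ_lt_succ hk)

theorem Conc.finset_sup_le_cong {ι : Type w} {s : Finset ι} {f : ι → Conc L A} {γ : Cong L A}
    (h : ∀ i ∈ s, (f i).1 ≤ γ) : (s.sup f).1 ≤ γ :=
  Finset.sup_induction (p := fun δ : Conc L A => δ.1 ≤ γ) (bot_le (a := γ))
    (fun _ ha _ hb => sup_le (α := Cong L A) ha hb) h

/-- The join of finitely many congruences is the transitive closure of their union. -/
theorem Conc.exists_seq_of_le_sup {X : Finset (Conc L A)} {a b : A}
    (h : Conc.principal L a b ≤ X.sup id) :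
    ∃ (n : ℕ) (c : ℕ → A), c 0 = a ∧ c n = b ∧
      ∀ k < n, ∃ d ∈ X, Conc.principal L (c k) (c (k + 1)) ≤ d := by
  let γ : Cong L A := Cong.ofTranslations (fun x y => ∃ d ∈ X, d.1.r x y)
    (fun x y ⟨d, hd, h⟩ => ⟨d, hd, Cong.symm h⟩) (by
      rintro n f a i x y ⟨d, hd, h⟩
      refine ⟨d, hd, d.1.compat f _ _ fun j => ?_⟩
      by_cases hj : j = i
      · subst hj
        simpa using h
      · simp [hj])
  have hγ : (X.sup id).1 ≤ γ := Conc.finset_sup_le_cong fun d hd x y hxy =>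
    Relation.ReflTransGen.single ⟨d, hd, hxy⟩
  obtain ⟨n, c, h0, hn, hc⟩ := Relation.ReflTransGen.exists_seq (hγ _ _ (Conc.principal_le.1 h))
  refine ⟨n, c, h0, hn, fun k hk => ?_⟩
  obtain ⟨d, hd, h⟩ := hc k hk
  exact ⟨d, hd, Conc.principal_le.2 h⟩

/-! ### Mal'cev chains -/

/-- All values of subterms of `t` at the assignment `a` are in `C`. -/
def TermInside (C : Set A) {V : Type w} (a : V → A) : L.Term V → Prop
  | .var i => a i ∈ C
  | .func f ts => (∀ i, TermInside C a (ts i)) ∧ (Term.func f ts).realize a ∈ C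

theorem TermInside.mono {C D : Set A} (h : C ⊆ D) {V : Type w} {a : V → A} {t : L.Term V}
    (ht : TermInside C a t) : TermInside D a t := by
  induction t with
  | var i => exact h ht
  | func f ts ih => exact ⟨fun i => ih i (ht.1 i), h ht.2⟩

theorem TermInside.realize_mem {C : Set A} {V : Type w} {a : V → A} {t : L.Term V}
    (ht : TermInside C a t) : t.realize a ∈ C := by
  cases t with
  | var i => exact ht
  | func f ts => exact ht.2

theorem exists_termInside {V : Type w} (a : V → A) (t : L.Term V) :
    ∃ F : Finset A, TermInside (F : Set A) a t := by
  classical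
  induction t with
  | var i => exact ⟨{a i}, by simp [TermInside]⟩
  | func f ts ih =>
    choose F hF using ih
    refine ⟨insert ((Term.func f ts).realize a) (Finset.univ.biUnion F), fun i =>
      (hF i).mono ?_, by simp⟩
    intro x hx
    exact Finset.mem_coe.2 (Finset.mem_insert_of_mem
      (Finset.mem_biUnion.2 ⟨i, Finset.mem_univ i, hx⟩))

/-- The assignment given by a set of pairs, with all elements of the algebra as parameters. -/
def pairAssign (E : Finset (A × A)) : (E ⊕ E) ⊕ A → A :=
  Sum.elim (Sum.elim (fun e => e.1.1) fun e => e.1.2) id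

/-- The assignment `pairAssign E` with all pairs swapped. -/
def swapAssign (E : Finset (A × A)) : (E ⊕ E) ⊕ A → A :=
  Sum.elim (Sum.elim (fun e => e.1.2) fun e => e.1.1) id

/-- The elements `a`, `b` are joined modulo `θ` by a Mal'cev chain for the pairs in `E`, all values
of which are in `F`. -/
def MalcevChain (θ : Cong L A) (E : Finset (A × A)) (F : Set A) (a b : A) : Prop :=
  ∃ (n : ℕ) (t : ℕ → L.Term ((E ⊕ E) ⊕ A)), 0 < n ∧
    (∀ j, j ≤ n → TermInside F (pairAssign E) (t j) ∧ TermInside F (swapAssign E) (t j)) ∧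
    θ.r ((t 0).realize (pairAssign E)) a ∧ θ.r ((t n).realize (pairAssign E)) b ∧
    ∀ j < n, θ.r ((t j).realize (swapAssign E)) ((t (j + 1)).realize (pairAssign E))

theorem MalcevChain.mono {θ : Cong L A} {E : Finset (A × A)} {F F' : Set A} (h : F ⊆ F') {a b : A}
    (hab : MalcevChain θ E F a b) : MalcevChain θ E F' a b := by
  obtain ⟨n, t, hn, ht, h'⟩ := hab
  exact ⟨n, t, hn, fun j hj => ⟨(ht j hj).1.mono h, (ht j hj).2.mono h⟩, h'⟩

/-- One step of a Mal'cev chain. -/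
def MalcevStep (θ : Cong L A) (E : Finset (A × A)) (a b : A) : Prop :=
  ∃ t : L.Term ((E ⊕ E) ⊕ A), θ.r (t.realize (pairAssign E)) a ∧ θ.r (t.realize (swapAssign E)) b

theorem MalcevStep.of_r {θ : Cong L A} {E : Finset (A × A)} {a b : A} (h : θ.r a b) :
    MalcevStep θ E a b := ⟨.var (.inr a), θ.refl a, h⟩

/-- Interchanging the two copies of `E` among the variables of the term exchanges the two
assignments. -/
theorem MalcevStep.symm {θ : Cong L A} {E : Finset (A × A)} {a b : A} (h : MalcevStep θ E a b) :
    MalcevStep θ E b a := by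
  obtain ⟨t, h, h'⟩ := h
  refine ⟨t.relabel (Sum.map Sum.swap id), ?_, ?_⟩
  · rw [Term.realize_relabel]
    convert h' using 2
    funext x
    rcases x with (e | e) | x <;> rfl
  · rw [Term.realize_relabel]
    convert h using 2
    funext x
    rcases x with (e | e) | x <;> rfl

/-- The other arguments of `f` enter the new term as parameters; for this every element of `A` is
available as a variable, with the same value under both assignments. -/
theorem MalcevStep.translate {θ : Cong L A} {E : Finset (A × A)} {n : ℕ} (f : L.Functions n)
    (a : Fin n → A) (i : Fin n) (x y : A) (h : MalcevStep θ E x y) :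
    MalcevStep θ E (Structure.funMap f (Function.update a i x))
      (Structure.funMap f (Function.update a i y)) := by
  obtain ⟨t, h, h'⟩ := h
  refine ⟨.func f (Function.update (fun j => .var (.inr (a j))) i t), ?_, ?_⟩
  all_goals
    refine θ.compat f _ _ fun j => ?_
    by_cases hj : j = i
    · subst hj
      simpa using by assumption
    · simp [hj, pairAssign, swapAssign]

/-- The transitive closure of `MalcevStep` is a congruence that contains `θ` and all pairs of `E`,
so `a` and `b` are joined by finitely many steps. The terms involved have finitely many subterm
values, which make up `F`. -/
theorem exists_malcevChain {θ : Cong L A} {E : Finset (A × A)} {a b : A}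
    (h : (θ ⊔ (E.sup fun e => Conc.principal L e.1 e.2).1).r a b) :
    ∃ F : Finset A, MalcevChain θ E F a b := by
  classical
  let γ : Cong L A := Cong.ofTranslations (MalcevStep θ E) (fun _ _ => MalcevStep.symm)
    MalcevStep.translate
  have hγ : θ ⊔ (E.sup fun e => Conc.principal L e.1 e.2).1 ≤ γ := by
    refine sup_le (fun x y hxy => .single (.of_r hxy)) (Conc.finset_sup_le_cong fun e he => ?_)
    exact Cong.principal_le.2 (.single ⟨.var (.inl (.inl ⟨e, he⟩)), θ.refl _, θ.refl _⟩)
  obtain ⟨n, c, rfl, rfl, hc⟩ := Relation.ReflTransGen.exists_seq (hγ _ _ h)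
  have : Nonempty (L.Term ((E ⊕ E) ⊕ A)) := ⟨.var (.inr (c 0))⟩
  choose! t ht ht' using hc
  -- A step runs from an unswapped value to a swapped one, while a chain must end with an unswapped
  -- value; hence the constant term `c n` is appended.
  let s : ℕ → L.Term ((E ⊕ E) ⊕ A) := fun j => if j < n then t j else .var (.inr (c n))
  have hs : ∀ j ≤ n, θ.r ((s j).realize (pairAssign E)) (c j) := by
    intro j hj
    by_cases hjn : j < n
    · simpa [s, hjn] using ht j hjn
    · obtain rfl : j = n := by omega
      simp [s, pairAssign]
  have hs' : ∀ j, j < n → θ.r ((s j).realize (swapAssign E)) (c (j + 1)) := by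
    intro j hj
    simpa [s, hj] using ht' j hj
  choose F hF using fun t : L.Term ((E ⊕ E) ⊕ A) => exists_termInside (pairAssign E) t
  choose F' hF' using fun t : L.Term ((E ⊕ E) ⊕ A) => exists_termInside (swapAssign E) t
  -- The length `n + 1` makes the chain nonempty even for `n = 0`; its last two terms are the
  -- constant `c n`.
  refine ⟨(Finset.range (n + 2)).biUnion fun j => F (s j) ∪ F' (s j), n + 1, s, n.succ_pos,
    fun j hj => ⟨(hF _).mono ?_, (hF' _).mono ?_⟩, hs 0 n.zero_le, ?_, fun j hj => ?_⟩
  · exact Finset.coe_subset.2 (Finset.subset_union_left.trans (Finset.subset_biUnion_of_mem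
      (fun j => F (s j) ∪ F' (s j)) (Finset.mem_range.2 (Nat.lt_succ_of_le hj))))
  · exact Finset.coe_subset.2 (Finset.subset_union_right.trans (Finset.subset_biUnion_of_mem
      (fun j => F (s j) ∪ F' (s j)) (Finset.mem_range.2 (Nat.lt_succ_of_le hj))))
  · simp [s, pairAssign]
  · rcases Nat.lt_succ_iff_lt_or_eq.1 hj with hj | rfl
    · exact Cong.trans (hs' j hj) (Cong.symm (hs (j + 1) hj))
    · simp [s, pairAssign, swapAssign]

end Chains

/-! ### Finite approximations of an algebra -/

section Stages

variable {L : FirstOrder.Language.{u, u'}} [L.IsAlgebraic] {B : Type v} [L.Structure B]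

/-- The subsets `C₀ ⊆ C` of `B` are large enough, with respect to the subset `D` and the
congruence `θ`, for their images in `B / θ` to form a gamp with the required properties. -/
structure IsStage (θ : Cong L B) (D C₀ C : Set B) : Prop where
  subset : D ⊆ C₀
  funMap_mem : ∀ {n : ℕ} (f : L.Functions n) (a : Fin n → B), (∀ i, a i ∈ D) →
    Structure.funMap f a ∈ C₀
  subset' : C₀ ⊆ C
  funMap_mem' : ∀ {n : ℕ} (f : L.Functions n) (a : Fin n → B), (∀ i, a i ∈ C₀) →
    Structure.funMap f a ∈ C
  generated : ∀ d : Conc L θ.Quo, ∃ E : Finset (B × B), (∀ e ∈ E, e.1 ∈ C₀ ∧ e.2 ∈ C₀) ∧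
    d = E.sup fun e => Conc.principal L (θ.proj e.1) (θ.proj e.2)
  tractable : ∀ E : Finset (B × B), (∀ e ∈ E, e.1 ∈ C₀ ∧ e.2 ∈ C₀) → ∀ a ∈ C₀, ∀ b ∈ C₀,
    (θ ⊔ (E.sup fun e => Conc.principal L e.1 e.2).1).r a b →
      ∃ F : Finset B, (F : Set B) ⊆ C ∧ MalcevChain θ E F a b
  -- The endpoints are prescribed only modulo `θ`, as the sequence is lifted from `B / θ`.
  cuttable : ∀ X : Finset (Conc L θ.Quo), ∀ a ∈ D, ∀ b ∈ D,
    Conc.principal L (θ.proj a) (θ.proj b) ≤ X.sup id →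
      ∃ (n : ℕ) (c : ℕ → B), θ.r (c 0) a ∧ θ.r (c n) b ∧ (∀ k ≤ n, c k ∈ C₀) ∧
        ∀ k < n, ∃ d ∈ X, Conc.principal L (θ.proj (c k)) (θ.proj (c (k + 1))) ≤ d

theorem IsStage.mono {θ : Cong L B} {D D' C₀ C : Set B} (h : IsStage θ D C₀ C) (hD : D' ⊆ D) :
    IsStage θ D' C₀ C where
  subset := hD.trans h.subset
  funMap_mem f a ha := h.funMap_mem f a fun i => hD (ha i)
  subset' := h.subset'
  funMap_mem' := h.funMap_mem'
  generated := h.generated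
  tractable := h.tractable
  cuttable X a ha b hb := h.cuttable X a (hD ha) b (hD hb)

theorem exists_finset_generating (θ : Cong L B) (d : Conc L θ.Quo) : ∃ E : Finset (B × B),
    d = E.sup fun e => Conc.principal L (θ.proj e.1) (θ.proj e.2) := by
  obtain ⟨α, rfl⟩ := Conc.map_surjective θ.proj_surjective d
  obtain ⟨E, rfl⟩ := α.exists_eq_sup
  refine ⟨E, ?_⟩
  rw [map_finset_sup]
  exact Finset.sup_congr rfl fun e _ => Conc.map_principal _ _ _

theorem exists_cut (θ : Cong L B) {X : Finset (Conc L θ.Quo)} {a b : B}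
    (h : Conc.principal L (θ.proj a) (θ.proj b) ≤ X.sup id) :
    ∃ (n : ℕ) (c : ℕ → B), θ.r (c 0) a ∧ θ.r (c n) b ∧
      ∀ k < n, ∃ d ∈ X, Conc.principal L (θ.proj (c k)) (θ.proj (c (k + 1))) ≤ d := by
  obtain ⟨n, c, h0, hn, hc⟩ := Conc.exists_seq_of_le_sup h
  choose g hg using θ.proj_surjective
  refine ⟨n, fun k => g (c k), ?_, ?_, fun k hk => ?_⟩
  · rw [← Cong.proj_eq, hg, h0]
  · rw [← Cong.proj_eq, hg, hn]
  · simpa only [hg] using hc k hk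

/-- This is the stage used at maximal elements of `P`, where no finiteness is available or needed.
-/
theorem isStage_univ (θ : Cong L B) (D : Set B) : IsStage θ D Set.univ Set.univ where
  subset := Set.subset_univ _
  funMap_mem _ _ _ := Set.mem_univ _
  subset' := Set.subset_univ _
  funMap_mem' _ _ _ := Set.mem_univ _
  generated d := by
    obtain ⟨E, h⟩ := exists_finset_generating θ d
    exact ⟨E, fun _ _ => ⟨Set.mem_univ _, Set.mem_univ _⟩, h⟩
  tractable E _ a _ b _ h := by
    obtain ⟨F, hF⟩ := exists_malcevChain h
    exact ⟨F, Set.subset_univ _, hF⟩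
  cuttable X a _ b _ h := by
    obtain ⟨n, c, h0, hn, hc⟩ := exists_cut θ h
    exact ⟨n, c, h0, hn, fun _ _ => Set.mem_univ _, hc⟩

omit [L.IsAlgebraic] in
-- This is where the finiteness of the similarity type enters: only finitely many operations are
-- applied to finitely many tuples.
theorem finite_funMap (hL : Finite (Σ n, L.Functions n)) {D : Set B} (hD : D.Finite) :
    {b : B | ∃ (n : ℕ) (f : L.Functions n) (a : Fin n → B), (∀ i, a i ∈ D) ∧
      Structure.funMap f a = b}.Finite := by
  have := hD.to_subtype
  refine (Set.finite_range fun e : Σ s : (Σ n, L.Functions n), (Fin s.1 → D) =>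
    Structure.funMap e.1.2 fun i => (e.2 i : B)).subset ?_
  rintro b ⟨n, f, a, ha, rfl⟩
  exact ⟨⟨⟨n, f⟩, fun i => ⟨a i, ha i⟩⟩, rfl⟩

theorem exists_finset_forall {α : Type v} {ι : Type w} [Finite ι] {Q : ι → Set α → Prop}
    (hQ : ∀ i F F', F ⊆ F' → Q i F → Q i F') (h : ∀ i, ∃ F : Finset α, Q i F) :
    ∃ F : Finset α, ∀ i, Q i F := by
  classical
  have := Fintype.ofFinite ι
  choose F hF using h
  exact ⟨Finset.univ.biUnion F, fun i => hQ i _ _ (Finset.coe_subset.2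
    (Finset.subset_biUnion_of_mem F (Finset.mem_univ i))) (hF i)⟩

omit [L.IsAlgebraic] in
-- Working with sets of pairs instead of lists leaves finitely many cases, namely the subsets of `K
-- ×ˢ K` together with the endpoints in `K`; the witnesses for all of them are united.
theorem exists_finset_malcevChain (θ : Cong L B) {C₀ : Set B} (hC₀ : C₀.Finite) :
    ∃ M : Finset B, ∀ E : Finset (B × B), (∀ e ∈ E, e.1 ∈ C₀ ∧ e.2 ∈ C₀) → ∀ a ∈ C₀, ∀ b ∈ C₀,
      (θ ⊔ (E.sup fun e => Conc.principal L e.1 e.2).1).r a b →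
        MalcevChain θ E (M : Set B) a b := by
  classical
  obtain ⟨K, rfl⟩ := hC₀.exists_finset_coe
  obtain ⟨M, hM⟩ : ∃ M : Finset B, ∀ i : (K ×ˢ K).powerset × K × K,
      (θ ⊔ (i.1.1.sup fun e => Conc.principal L e.1 e.2).1).r i.2.1 i.2.2 →
        MalcevChain θ i.1.1 (M : Set B) i.2.1 i.2.2 := by
    refine exists_finset_forall (Q := fun (i : (K ×ˢ K).powerset × K × K) M =>
      (θ ⊔ (i.1.1.sup fun e => Conc.principal L e.1 e.2).1).r i.2.1 i.2.2 →
        MalcevChain θ i.1.1 M i.2.1 i.2.2) (fun i F F' h hF hi => (hF hi).mono h) fun i => ?_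
    by_cases hi : (θ ⊔ (i.1.1.sup fun e => Conc.principal L e.1 e.2).1).r i.2.1 i.2.2
    · obtain ⟨F, hF⟩ := exists_malcevChain hi
      exact ⟨F, fun _ => hF⟩
    · exact ⟨∅, fun h => absurd h hi⟩
  refine ⟨M, fun E hE a ha b hb hab => hM (⟨E, Finset.mem_powerset.2 fun e he => ?_⟩, ⟨a, ha⟩,
    ⟨b, hb⟩) hab⟩
  exact Finset.mem_product.2 (hE e he)

/-- Since `Con_c (B / θ)` is finite, finitely many elements `G` generate all distances and finitely
many elements `H` provide all cuts between elements of `D`. With `D` and the values of the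
operations on `D` they make up `C₀`. Only then can the Mal'cev chains between elements of `C₀` be
chosen; their values `M` go into the larger set `C`, so nothing has to be iterated. -/
theorem exists_finite_isStage (hL : Finite (Σ n, L.Functions n)) (θ : Cong L B)
    [Finite (Conc L θ.Quo)] {D : Set B} (hD : D.Finite) :
    ∃ C₀ C : Set B, C₀.Finite ∧ C.Finite ∧ IsStage θ D C₀ C := by
  classical
  have := hD.to_subtype
  obtain ⟨G, hG⟩ : ∃ G : Finset B, ∀ d : Conc L θ.Quo, ∃ E : Finset (B × B),
      (∀ e ∈ E, e.1 ∈ (G : Set B) ∧ e.2 ∈ (G : Set B)) ∧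
      d = E.sup fun e => Conc.principal L (θ.proj e.1) (θ.proj e.2) := by
    refine exists_finset_forall (Q := fun d F => ∃ E : Finset (B × B),
      (∀ e ∈ E, e.1 ∈ F ∧ e.2 ∈ F) ∧
      d = E.sup fun e => Conc.principal L (θ.proj e.1) (θ.proj e.2)) ?_ ?_
    · rintro d F F' h ⟨E, hE, hd⟩
      exact ⟨E, fun e he => ⟨h (hE e he).1, h (hE e he).2⟩, hd⟩
    · intro d
      obtain ⟨E, hE⟩ := exists_finset_generating θ d
      refine ⟨E.image Prod.fst ∪ E.image Prod.snd, E, fun e he => ⟨?_, ?_⟩, hE⟩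
      · exact Finset.mem_union_left _ (Finset.mem_image_of_mem _ he)
      · exact Finset.mem_union_right _ (Finset.mem_image_of_mem _ he)
  obtain ⟨H, hH⟩ : ∃ H : Finset B, ∀ i : Finset (Conc L θ.Quo) × D × D,
      Conc.principal L (θ.proj i.2.1) (θ.proj i.2.2) ≤ i.1.sup id →
      ∃ (n : ℕ) (c : ℕ → B), θ.r (c 0) i.2.1 ∧ θ.r (c n) i.2.2 ∧ (∀ k ≤ n, c k ∈ (H : Set B)) ∧
        ∀ k < n, ∃ d ∈ i.1, Conc.principal L (θ.proj (c k)) (θ.proj (c (k + 1))) ≤ d := by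
    refine exists_finset_forall (Q := fun (i : Finset (Conc L θ.Quo) × D × D) H =>
      Conc.principal L (θ.proj i.2.1) (θ.proj i.2.2) ≤ i.1.sup id →
      ∃ (n : ℕ) (c : ℕ → B), θ.r (c 0) i.2.1 ∧ θ.r (c n) i.2.2 ∧ (∀ k ≤ n, c k ∈ H) ∧
        ∀ k < n, ∃ d ∈ i.1, Conc.principal L (θ.proj (c k)) (θ.proj (c (k + 1))) ≤ d) ?_ ?_
    · intro i F F' h hF hi
      obtain ⟨n, c, h0, hn, hc, hc'⟩ := hF hi
      exact ⟨n, c, h0, hn, fun k hk => h (hc k hk), hc'⟩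
    · intro i
      by_cases hi : Conc.principal L (θ.proj i.2.1) (θ.proj i.2.2) ≤ i.1.sup id
      · obtain ⟨n, c, h0, hn, hc⟩ := exists_cut θ hi
        exact ⟨(Finset.range (n + 1)).image c, fun _ => ⟨n, c, h0, hn, fun k hk =>
          Finset.mem_coe.2 (Finset.mem_image_of_mem c (Finset.mem_range.2 (Nat.lt_succ_of_le hk))),
          hc⟩⟩
      · exact ⟨∅, fun h => absurd h hi⟩
  let C₀ : Set B := D ∪ {b : B | ∃ (n : ℕ) (f : L.Functions n) (a : Fin n → B), (∀ i, a i ∈ D) ∧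
      Structure.funMap f a = b} ∪ (G ∪ H)
  have hC₀ : C₀.Finite :=
    (hD.union (finite_funMap hL hD)).union (G.finite_toSet.union H.finite_toSet)
  obtain ⟨M, hM⟩ := exists_finset_malcevChain θ hC₀
  refine ⟨C₀, C₀ ∪ {b : B | ∃ (n : ℕ) (f : L.Functions n) (a : Fin n → B), (∀ i, a i ∈ C₀) ∧
      Structure.funMap f a = b} ∪ M, hC₀,
    (hC₀.union (finite_funMap hL hC₀)).union M.finite_toSet, ?_⟩
  refine
    { subset := fun x hx => .inl (.inl hx)
      funMap_mem := fun f a ha => .inl (.inr ⟨_, f, a, ha, rfl⟩)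
      subset' := fun x hx => .inl (.inl hx)
      funMap_mem' := fun f a ha => .inl (.inr ⟨_, f, a, ha, rfl⟩)
      generated := fun d => ?_
      tractable := fun E hE a ha b hb hab => ?_
      cuttable := fun Y a ha b hb hab => ?_ }
  · obtain ⟨E, hE, hd⟩ := hG d
    exact ⟨E, fun e he => ⟨.inr (.inl (hE e he).1), .inr (.inl (hE e he).2)⟩, hd⟩
  · exact ⟨M, fun x hx => .inr hx, hM E hE a ha b hb hab⟩
  · obtain ⟨n, c, h0, hn, hc, hc'⟩ := hH (Y, ⟨a, ha⟩, ⟨b, hb⟩) hab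
    exact ⟨n, c, h0, hn, fun k hk => .inr (.inr (hc k hk)), hc'⟩

/-- Stages can be built along a lower finite poset, each one over all earlier ones. -/
theorem exists_isStage_tower (hL : Finite (Σ n, L.Functions n)) {T : Type w} [PartialOrder T]
    (hT : ∀ t : T, (Set.Iio t).Finite) (θ : T → Cong L B) (hθ : ∀ t, Finite (Conc L (θ t).Quo)) :
    ∃ C₀ C : T → Set B, (∀ t, (C t).Finite) ∧ ∀ t, IsStage (θ t) (⋃ s < t, C s) (C₀ t) (C t) := by
  -- As lower sets are finite, the number of elements strictly below `t` is a strictly increasing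
  -- rank.
  have hwf : WellFounded ((· < ·) : T → T → Prop) :=
    Subrelation.wf (fun {s t} hst => Set.ncard_lt_ncard
      (show Set.Iio s ⊂ Set.Iio t from ⟨Set.Iio_subset_Iio hst.le,
        fun h => lt_irrefl s (h (Set.mem_Iio.2 hst))⟩) (hT t))
      (measure fun t : T => (Set.Iio t).ncard).wf
  -- Finiteness is bundled with the sets, since the recursion must know that the union of the
  -- earlier stages is finite before it can choose the next one.
  have step : ∀ (t : T) (D : {D : Set B // D.Finite}), ∃ C : Set B × {C : Set B // C.Finite},
      IsStage (θ t) D C.1 C.2 := fun t D => by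
    have := hθ t
    obtain ⟨C₀, C, -, hC, h⟩ := exists_finite_isStage hL (θ t) D.2
    exact ⟨(C₀, ⟨C, hC⟩), h⟩
  choose g hg using step
  let D : (t : T) → (∀ s, s < t → {C : Set B // C.Finite}) → {D : Set B // D.Finite} :=
    fun t ih => ⟨⋃ s : Set.Iio t, (ih s.1 s.2).1, by
      have := (hT t).to_subtype
      exact Set.finite_iUnion fun s => (ih s.1 s.2).2⟩
  let C : T → {C : Set B // C.Finite} := hwf.fix fun t ih => (g t (D t ih)).2
  have hC : ∀ t, C t = (g t (D t fun s _ => C s)).2 := fun t => hwf.fix_eq _ t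
  refine ⟨fun t => (g t (D t fun s _ => C s)).1, fun t => (C t).1, fun t => (C t).2, fun t => ?_⟩
  have := hg t (D t fun s _ => C s)
  rw [← hC t] at this
  refine this.mono fun x hx => ?_
  simp only [Set.mem_iUnion] at hx
  obtain ⟨s, hs, hx⟩ := hx
  exact Set.mem_iUnion.2 ⟨⟨s, hs⟩, hx⟩

end Stages

end CLLGamp

namespace CLLGamp

open FirstOrder FirstOrder.Language

universe u u' v v' w x y

/-! ### Realizations -/

section Realization

variable {L : FirstOrder.Language.{u, u'}} [L.IsAlgebraic]

omit [L.IsAlgebraic] in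
theorem PartialAlg.Eval.realize {A : Type v} {M : PartialAlg L A} {B : Type v'} [L.Structure B]
    (g : A → B) (hg : ∀ {n : ℕ} (f : L.Functions n) (a : Fin n → A) (b : A), M.graph f a b →
      Structure.funMap f (fun i => g (a i)) = g b) {V : Type w} {a : V → A} {t : L.Term V} {b : A}
    (h : M.Eval a t b) : t.realize (fun i => g (a i)) = g b := by
  induction t generalizing b with
  | var i => exact congrArg g h
  | func f ts ih =>
    obtain ⟨c, hc, hb⟩ := h
    rw [← hg f c b hb, Term.realize]
    exact congrArg _ (funext fun i => ih i (hc i))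

/-- A gamp with an isomorphic realization in a variety is a gamp of this variety. -/
theorem Gamp.HasIsomorphicRealization.isOf {M : Gamp.{u, u', w} L} {W : Variety L}
    (h : M.HasIsomorphicRealization W) : M.IsOf W := by
  obtain ⟨A', _, e, χ, hW, he, hgraph, hδ⟩ := h
  intro I s t hst a b c hs ht
  -- The ideal of `Con_c A'` that corresponds to `I` under `χ`.
  let J : Order.Ideal (Conc L A') := kerIdeal
    ({ toFun := fun α => SemiQuot.mk I (χ.symm α)
       map_sup' := fun α β => by rw [map_sup, SemiQuot.mk_sup]
       map_bot' := by rw [map_bot, SemiQuot.mk_bot] } : SupBotHom (Conc L A') (SemiQuot I))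
  have hJ : ∀ p q, Conc.principal L (e p) (e q) ∈ J ↔ M.δ p q ∈ I := fun p q => by
    rw [mem_kerIdeal, ← hδ]
    change SemiQuot.mk I (χ.symm (χ _)) = ⊥ ↔ _
    rw [OrderIso.symm_apply_apply, SemiQuot.mk_eq_bot]
  -- The partial algebra `A / I` embeds into the quotient of `A'` by the congruence of `J`, a member
  -- of `W`; there both sides of the identity agree.
  let g : Quotient (M.setoid I) → (Cong.ofIdeal J).Quo :=
    Quotient.lift (fun p => (Cong.ofIdeal J).proj (e p))
      fun p q hpq => Cong.proj_eq.2 ((hJ p q).2 hpq)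
  have hg : ∀ p, g (M.proj I p) = (Cong.ofIdeal J).proj (e p) := fun _ => rfl
  have hginj : Function.Injective g := by
    intro p q hpq
    obtain ⟨p, rfl⟩ := M.proj_surjective I p
    obtain ⟨q, rfl⟩ := M.proj_surjective I q
    rw [hg, hg, Cong.proj_eq] at hpq
    exact Pregamp.proj_eq.2 ((hJ p q).1 hpq)
  have hgg : ∀ {n : ℕ} (f : L.Functions n) (x : Fin n → Quotient (M.setoid I)) (y),
      (M.toPregamp.quot I).alg.graph f x y → Structure.funMap f (fun i => g (x i)) = g y := by
    rintro n f _ _ ⟨x, y, hxy, rfl, rfl⟩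
    rw [hg, ← hgraph f x y hxy, (Cong.ofIdeal J).proj.map_fun]
    rfl
  apply hginj
  rw [← hs.realize g hgg, ← ht.realize g hgg]
  exact hst.realize_eq (hW.of_surjective _ (Cong.ofIdeal J).proj_surjective) _

end Realization

/-! ### The gamp of a stage -/

section StageGamp

variable {L : FirstOrder.Language.{u, u'}} [L.IsAlgebraic] {B : Type w} [L.Structure B]

/-- The image in `B / θ` of a subset `C` of `B`. -/
def StageCarrier (θ : Cong L B) (C : Set B) : Type w :=
  Quotient (θ.toSetoid.comap (Subtype.val : C → B))

namespace StageCarrier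

variable {θ : Cong L B} {C : Set B}

/-- The class of an element of `C`. -/
def cls (θ : Cong L B) {C : Set B} (c : C) : StageCarrier θ C :=
  Quotient.mk _ c

/-- The embedding into `B / θ`. -/
noncomputable def emb : StageCarrier θ C → θ.Quo :=
  Quotient.lift (fun c : C => θ.proj c.1) fun _ _ h => Cong.proj_eq.2 h

omit [L.IsAlgebraic] in
theorem cls_surjective : Function.Surjective (cls θ (C := C)) := Quotient.mk_surjective

theorem emb_cls (c : C) : emb (cls θ c) = θ.proj c.1 := rfl

theorem emb_injective : Function.Injective (emb (θ := θ) (C := C)) := by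
  intro a b h
  obtain ⟨a, rfl⟩ := cls_surjective a
  obtain ⟨b, rfl⟩ := cls_surjective b
  exact Quotient.sound (Cong.proj_eq.1 h)

theorem cls_eq {a b : C} : cls θ a = cls θ b ↔ θ.r a.1 b.1 := by
  rw [← emb_injective.eq_iff, emb_cls, emb_cls, Cong.proj_eq]

omit [L.IsAlgebraic] in
theorem finite (hC : C.Finite) : Finite (StageCarrier θ C) := by
  have := hC.to_subtype
  exact Finite.of_surjective _ (cls_surjective (θ := θ) (C := C))

end StageCarrier

open StageCarrier

theorem StageCarrier.funMap_emb {θ : Cong L B} {C : Set B} {n : ℕ} {f : L.Functions n}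
    {x : Fin n → C} {y : C} (h : Structure.funMap f (fun i => (x i).1) = y.1) :
    Structure.funMap f (fun i => emb (cls θ (x i))) = emb (cls θ y) := by
  rw [emb_cls, ← h, θ.proj.map_fun]
  rfl

/-- The pregamp formed by the image in `B / θ` of the subset `C` of `B`, with distances in
`Con_c (B / θ)`. -/
noncomputable def stagePregamp (θ : Cong L B) (C : Set B) : Pregamp.{u, u', w} L where
  carrier := StageCarrier θ C
  alg :=
    -- An operation is defined only where some representatives in `C` have their value, computed in
    -- `B`, again in `C`; the value is then that of `B / θ`.
    { graph := fun {n} f a b => ∃ (x : Fin n → C) (y : C),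
        Structure.funMap f (fun i => (x i).1) = y.1 ∧ a = (fun i => cls θ (x i)) ∧ b = cls θ y
      functional := by
        rintro n f a b c ⟨x, y, h, rfl, rfl⟩ ⟨x', y', h', e, rfl⟩
        apply emb_injective
        rw [← funMap_emb h, ← funMap_emb h']
        exact congrArg _ (funext fun i => congrArg emb (congrFun e i)) }
  dist := Conc L θ.Quo
  sup := Conc.instSemilatticeSup
  bot := Conc.instOrderBot
  δ a b := Conc.principal L (emb a) (emb b)
  δ_eq_bot a b := by rw [Conc.principal_eq_bot, emb_injective.eq_iff]
  δ_comm a b := (Pregamp.ofAlgebra L θ.Quo).δ_comm _ _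
  δ_triangle a b c := (Pregamp.ofAlgebra L θ.Quo).δ_triangle _ _ _
  δ_graph f a b c d := by
    rintro ⟨x, y, h, rfl, rfl⟩ ⟨x', y', h', rfl, rfl⟩
    exact (Pregamp.ofAlgebra L θ.Quo).δ_graph f _ _ _ _ (funMap_emb h) (funMap_emb h')

/-- The gamp formed by the images in `B / θ` of the subsets `C₀` and `C` of `B`, with distances in
`Con_c (B / θ)`. -/
noncomputable def stageGamp (θ : Cong L B) (C₀ C : Set B) : Gamp.{u, u', w} L where
  toPregamp := stagePregamp θ C
  star :=
    { carrier := {a | ∃ x : C, x.1 ∈ C₀ ∧ a = cls θ x}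
      graph := fun {n} f a b => ∃ (x : Fin n → C) (y : C),
        ((∀ i, (x i).1 ∈ C₀) ∧ y.1 ∈ C₀) ∧
        Structure.funMap f (fun i => (x i).1) = y.1 ∧ a = (fun i => cls θ (x i)) ∧ b = cls θ y
      mem_of_graph := by
        rintro n f a b ⟨x, y, ⟨hx, hy⟩, -, rfl, rfl⟩
        exact ⟨fun i => ⟨x i, hx i, rfl⟩, y, hy, rfl⟩
      graph_le := by
        rintro n f a b ⟨x, y, -, h⟩
        exact ⟨x, y, h⟩ }

variable {θ : Cong L B} {D C₀ C : Set B}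

/-- The algebra `B / θ` serves as realization: the distances already take their values in its
compact congruences. -/
theorem stageGamp_hasIsomorphicRealization {W : Variety L} (hB : W.Mem B) :
    (stageGamp θ C₀ C).HasIsomorphicRealization W := by
  refine ⟨θ.Quo, inferInstance, emb, OrderIso.refl _,
    hB.of_surjective θ.proj θ.proj_surjective, emb_injective, ?_, fun _ _ => rfl⟩
  rintro n f _ _ ⟨x, y, h, rfl, rfl⟩
  exact funMap_emb h

theorem IsStage.isStrong (h : IsStage θ D C₀ C) : (stageGamp θ C₀ C).IsStrong := by
  intro n f a ha
  choose x hx hax using ha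
  exact ⟨cls θ ⟨_, h.funMap_mem' f _ hx⟩, x, _, rfl, funext hax, rfl⟩

theorem IsStage.isDistanceGenerated (h : IsStage θ D C₀ C) :
    (stageGamp θ C₀ C).IsDistanceGenerated := by
  intro d
  obtain ⟨E, hE, hd⟩ := h.generated d
  have hC : ∀ i : Fin E.card, (E.equivFin.symm i).1.1 ∈ C₀ ∧ (E.equivFin.symm i).1.2 ∈ C₀ :=
    fun i => hE _ (E.equivFin.symm i).2
  refine ⟨E.card, fun i => cls θ ⟨(E.equivFin.symm i).1.1, h.subset' (hC i).1⟩,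
    fun i => cls θ ⟨(E.equivFin.symm i).1.2, h.subset' (hC i).2⟩, fun i => ⟨_, (hC i).1, rfl⟩,
    fun i => ⟨_, (hC i).2, rfl⟩, ?_⟩
  change @Eq (Conc L θ.Quo) d (Finset.univ.sup fun i => Conc.principal L
    (θ.proj (E.equivFin.symm i).1.1) (θ.proj (E.equivFin.symm i).1.2))
  rw [hd]
  refine eq_of_forall_ge_iff fun c => ?_
  rw [Finset.sup_le_iff, Finset.sup_le_iff]
  constructor
  · exact fun H i _ => H _ (E.equivFin.symm i).2
  · intro H e he
    have := H (E.equivFin ⟨e, he⟩) (Finset.mem_univ _)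
    rwa [Equiv.symm_apply_apply] at this

/-- All subterm values remain in `F ⊆ C`, so each operation performed is defined in the stage. The
assignment `a` has to match `asg` only at variables with values in `F`, because no others occur in
`t`. -/
theorem stageGamp_eval {F : Set B} (hF : F ⊆ C) {V : Type v} {V' : Type v'} {asg : V → B}
    {a : V' → StageCarrier θ C} {g : V → V'} {t : L.Term V}
    (hg : ∀ i, asg i ∈ F → emb (a (g i)) = θ.proj (asg i)) (ht : TermInside F asg t)
    {c : StageCarrier θ C} (hc : emb c = θ.proj (t.realize asg)) :
    (stageGamp θ C₀ C).alg.Eval a (t.relabel g) c := by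
  induction t generalizing c with
  | var i =>
    apply emb_injective
    rw [hc]
    exact hg i ht
  | func f ts ih =>
    refine ⟨fun i => cls θ ⟨_, hF (ht.1 i).realize_mem⟩, fun i => ih i (ht.1 i) rfl,
      fun i => ⟨_, hF (ht.1 i).realize_mem⟩, ⟨_, hF ht.2⟩, rfl, rfl, emb_injective ?_⟩
    rw [hc, emb_cls]

/-- As `Con_c` of the projection is ideal-induced, an inequality between distances in `B / θ` holds
in `B` up to some compact congruence `γ` below `θ`. -/
theorem Cong.r_sup_of_le {α : Conc L B} {a b : B}
    (h : Conc.principal L (θ.proj a) (θ.proj b) ≤ Conc.map θ.proj α) : (θ ⊔ α.1).r a b := by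
  rw [← Conc.map_principal] at h
  obtain ⟨γ, hγ, hle⟩ := (Conc.map_isIdealInduced θ.proj_surjective).exists_le _ _ h
  have hγθ : γ.1 ≤ θ := fun x y hxy => by
    rw [← Conc.principal_proj_eq_bot, ← le_bot_iff, ← hγ, ← Conc.map_principal]
    exact OrderHomClass.mono _ (Conc.principal_le.2 hxy)
  have : (α ⊔ γ).1 ≤ θ ⊔ α.1 := sup_le (α := Cong L B) le_sup_right (hγθ.trans le_sup_left)
  exact this _ _ (Conc.principal_le.1 hle)

theorem IsStage.isCongruenceTractable (h : IsStage θ D C₀ C) :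
    (stageGamp θ C₀ C).IsCongruenceTractable := by
  classical
  intro m a b as bs ha hb has hbs hab
  obtain ⟨x, hx, rfl⟩ := ha
  obtain ⟨y, hy, rfl⟩ := hb
  choose xs hxs hxs' using has
  choose ys hys hys' using hbs
  obtain rfl := funext hxs'
  obtain rfl := funext hys'
  -- Passing to a set of pairs forgets repetitions; `ι` below selects an index for each pair, so
  -- that variables for pairs can be renamed to list variables.
  let E : Finset (B × B) := Finset.univ.image fun i => ((xs i).1, (ys i).1)
  have hE : ∀ e : E, ∃ i, ((xs i).1, (ys i).1) = e.1 := fun e => by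
    obtain ⟨i, -, hi⟩ := Finset.mem_image.1 e.2
    exact ⟨i, hi⟩
  choose ι hι using hE
  have hι1 : ∀ e : E, (xs (ι e)).1 = e.1.1 := fun e => congrArg Prod.fst (hι e)
  have hι2 : ∀ e : E, (ys (ι e)).1 = e.1.2 := fun e => congrArg Prod.snd (hι e)
  obtain ⟨F, hF, n, t, hn, ht, h0, hlast, hstep⟩ := h.tractable E (by
    intro e he
    rw [← hι1 ⟨e, he⟩, ← hι2 ⟨e, he⟩]
    exact ⟨hxs _, hys _⟩) x hx y hy (Cong.r_sup_of_le (by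
      rw [map_finset_sup, Finset.sup_image]
      simp only [Function.comp_def, Conc.map_principal]
      exact hab))
  -- Parameters outside `F` do not occur in the chain, but the renaming `g` is total and needs a
  -- default index for them.
  have hF0 : 0 < F.card := Finset.card_pos.2 ⟨_, (ht 0 n.zero_le).1.realize_mem⟩
  let z : Fin F.card → StageCarrier θ C := fun i =>
    cls θ ⟨(F.equivFin.symm i).1, hF (F.equivFin.symm i).2⟩
  let g : (E ⊕ E) ⊕ B → Fin m ⊕ Fin m ⊕ Fin F.card :=
    Sum.elim (Sum.elim (fun e => .inl (ι e)) fun e => .inr (.inl (ι e))) fun c =>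
      .inr (.inr (if hc : c ∈ F then F.equivFin ⟨c, hc⟩ else ⟨0, hF0⟩))
  have hz : ∀ c (hc : c ∈ F), emb (z (F.equivFin ⟨c, hc⟩)) = θ.proj c := fun c hc => by
    simp only [z, emb_cls, Equiv.symm_apply_apply]
  have hg : ∀ i, pairAssign E i ∈ (F : Set B) → emb (Sum.elim (fun i => cls θ (xs i))
      (Sum.elim (fun i => cls θ (ys i)) z) (g i)) = θ.proj (pairAssign E i) := by
    rintro ((e | e) | c) hc
    · exact congrArg θ.proj (hι1 e)
    · exact congrArg θ.proj (hι2 e)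
    · have hc : c ∈ F := hc
      simpa [g, hc, pairAssign, swapAssign] using hz c hc
  have hg' : ∀ i, swapAssign E i ∈ (F : Set B) → emb (Sum.elim (fun i => cls θ (ys i))
      (Sum.elim (fun i => cls θ (xs i)) z) (g i)) = θ.proj (swapAssign E i) := by
    rintro ((e | e) | c) hc
    · exact congrArg θ.proj (hι2 e)
    · exact congrArg θ.proj (hι1 e)
    · have hc : c ∈ F := hc
      simpa [g, hc, pairAssign, swapAssign] using hz c hc
  refine ⟨n, F.card, z, fun j => (t j).relabel g, hn,
    stageGamp_eval hF hg (ht 0 n.zero_le).1 (Cong.proj_eq.2 (Cong.symm h0)),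
    stageGamp_eval hF hg (ht n le_rfl).1 (Cong.proj_eq.2 (Cong.symm hlast)), fun j hj => ?_⟩
  refine ⟨cls θ ⟨_, hF (ht j hj.le).2.realize_mem⟩, stageGamp_eval hF hg' (ht j hj.le).2 rfl,
    stageGamp_eval hF hg (ht (j + 1) hj).1 (Cong.proj_eq.2 (hstep j hj))⟩

end StageGamp

end CLLGamp

namespace CLLGamp

open FirstOrder FirstOrder.Language StageCarrier

universe u u' v v' w x y y'

section Assembly

variable {L : FirstOrder.Language.{u, u'}} [L.IsAlgebraic] {B : Type w} [L.Structure B]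

/-! ### Morphisms between stages -/

/-- The map induced by an inclusion of subsets of `B`. -/
def StageCarrier.map {θ θ' : Cong L B} {C C' : Set B} (hC : C ⊆ C')
    (h : ∀ a ∈ C, ∀ b ∈ C, θ.r a b → θ'.r a b) : StageCarrier θ C → StageCarrier θ' C' :=
  Quotient.lift (fun c : C => cls θ' ⟨c.1, hC c.2⟩)
    fun a b hab => Quotient.sound (h a.1 a.2 b.1 b.2 hab)

/-- The morphism of gamps induced by an inclusion of subsets of `B`. -/
noncomputable def stageHom {θ θ' : Cong L B} {C₀ C C₀' C' : Set B} (hC₀ : C₀ ⊆ C₀') (hC : C ⊆ C')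
    (φ : SupBotHom (Conc L θ.Quo) (Conc L θ'.Quo))
    (hφ : ∀ a ∈ C, ∀ b ∈ C, Conc.principal L (θ'.proj a) (θ'.proj b) =
      φ (Conc.principal L (θ.proj a) (θ.proj b))) :
    Gamp.Hom (stageGamp θ C₀ C) (stageGamp θ' C₀' C') where
  toFun := StageCarrier.map hC fun a ha b hb hab => by
    rw [← Conc.principal_proj_eq_bot, hφ a ha b hb, Conc.principal_proj_eq_bot.2 hab, map_bot]
  distHom := φ
  map_graph := by
    rintro n f _ _ ⟨x, y, h, rfl, rfl⟩
    exact ⟨fun i => ⟨x i, hC (x i).2⟩, ⟨y, hC y.2⟩, h, rfl, rfl⟩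
  map_δ a b := by
    obtain ⟨a, rfl⟩ := cls_surjective a
    obtain ⟨b, rfl⟩ := cls_surjective b
    exact hφ a.1 a.2 b.1 b.2
  map_star := by
    rintro _ ⟨x, hx, rfl⟩
    exact ⟨⟨x, hC x.2⟩, hC₀ hx, rfl⟩
  map_star_graph := by
    rintro n f _ _ ⟨x, y, ⟨hx, hy⟩, h, rfl, rfl⟩
    exact ⟨fun i => ⟨x i, hC (x i).2⟩, ⟨y, hC y.2⟩, ⟨fun i => hC₀ (hx i), hC₀ hy⟩, h, rfl, rfl⟩

section

variable {θ θ' : Cong L B} {C₀ C C₀' C' D : Set B} {hC₀ : C₀ ⊆ C₀'} {hC : C ⊆ C'}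
  {φ : SupBotHom (Conc L θ.Quo) (Conc L θ'.Quo)}
  {hφ : ∀ a ∈ C, ∀ b ∈ C, Conc.principal L (θ'.proj a) (θ'.proj b) =
    φ (Conc.principal L (θ.proj a) (θ.proj b))}

theorem IsStage.rangeSubStar (h : IsStage θ' D C₀' C') (hD : C ⊆ D) :
    (stageHom (C₀ := C₀) (C₀' := C₀') hC₀ hC φ hφ).RangeSubStar := by
  refine ⟨fun a => ?_, ?_⟩
  · obtain ⟨a, rfl⟩ := cls_surjective a
    exact ⟨⟨a, hC a.2⟩, h.subset (hD a.2), rfl⟩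
  · rintro n f _ _ ⟨x, y, hxy, rfl, rfl⟩
    exact ⟨fun i => ⟨x i, hC (x i).2⟩, ⟨y, hC y.2⟩, ⟨fun i => h.subset (hD (x i).2),
      h.subset (hD y.2)⟩, hxy, rfl, rfl⟩

theorem IsStage.stageHom_isStrong (h : IsStage θ' D C₀' C') (hD : C ⊆ D) :
    (stageHom (C₀ := C₀) (C₀' := C₀') hC₀ hC φ hφ).IsStrong := by
  refine ⟨h.rangeSubStar hD, fun {n} f a => ?_⟩
  choose x hx using fun i => cls_surjective (θ := θ) (C := C) (a i)
  obtain rfl := funext hx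
  have hmem := h.funMap_mem f (fun i => (x i).1) fun i => hD (x i).2
  exact ⟨cls θ' ⟨_, h.subset' hmem⟩, fun i => ⟨x i, hC (x i).2⟩, ⟨_, h.subset' hmem⟩,
    ⟨fun i => h.subset (hD (x i).2), hmem⟩, rfl, rfl, rfl⟩

theorem IsStage.stageHom_isCongruenceCuttable (h : IsStage θ' D C₀' C') (hD : C ⊆ D) :
    (stageHom (C₀ := C₀) (C₀' := C₀') hC₀ hC φ hφ).IsCongruenceCuttable := by
  refine ⟨h.rangeSubStar hD, fun Y a b hab => ?_⟩
  obtain ⟨a, rfl⟩ := cls_surjective a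
  obtain ⟨b, rfl⟩ := cls_surjective b
  obtain ⟨n, c, h0, hn, hc, hc'⟩ := h.cuttable Y a (hD a.2) b (hD b.2) hab
  -- The sequence is known to be in `C₀'` only up to `n`; truncating the index makes it a total
  -- function into the stage.
  have hmem : ∀ k, c (min k n) ∈ C₀' := fun k => hc _ (min_le_right k n)
  refine ⟨n, fun k => cls θ' ⟨c (min k n), h.subset' (hmem k)⟩, ?_, ?_,
    fun k _ => ⟨_, hmem k, rfl⟩, fun k hk => ?_⟩
  · exact cls_eq.2 (by simpa using h0)
  · exact cls_eq.2 (by simpa using hn)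
  · obtain ⟨d, hd, hle⟩ := hc' k hk
    refine ⟨d, hd, ?_⟩
    change Conc.principal L (θ'.proj (c (min k n))) (θ'.proj (c (min (k + 1) n))) ≤ d
    rwa [min_eq_left hk.le, min_eq_left (Nat.succ_le_of_lt hk)]

end

/-! ### The diagram of stages -/

/-- Both semilattices are ideal-induced images of `Con_c B`. The hypothesis compares the kernels on
principal congruences only, which suffices since an ideal is determined by its congruence. -/
theorem exists_orderIso_conc_quo {S : Type v} [SemilatticeSup S] [OrderBot S] {θ : Cong L B}
    {ρ : SupBotHom (Conc L B) S} (hρ : IsIdealInduced ρ)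
    (hθ : ∀ a b, θ.r a b ↔ ρ (Conc.principal L a b) = ⊥) :
    ∃ e : Conc L θ.Quo ≃o S, ∀ α, e (Conc.map θ.proj α) = ρ α := by
  refine (Conc.map_isIdealInduced θ.proj_surjective).exists_orderIso hρ fun α => ?_
  have h₁ : θ = Cong.ofIdeal (kerIdeal ρ) := Cong.ext' hθ
  have h₂ : θ = Cong.ofIdeal (kerIdeal (Conc.map θ.proj)) := Cong.ext' fun a b => by
    rw [Cong.ofIdeal_r, mem_kerIdeal, Conc.map_principal, Conc.principal_proj_eq_bot]
  rw [← mem_kerIdeal, ← mem_kerIdeal, ← Cong.le_ofIdeal, ← Cong.le_ofIdeal, ← h₁, ← h₂]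

/-- The ideal is the kernel of `ρ`. Carriers agree because `θ` is its congruence, and distances
agree because `Con_c (B / θ)` and the quotient of `Con_c B` by the ideal are images with the same
kernel. -/
theorem stageGamp_univ_isQuotientOf {S : Type v} [SemilatticeSup S] [OrderBot S] {θ : Cong L B}
    {ρ : SupBotHom (Conc L B) S}
    (hθ : ∀ a b, θ.r a b ↔ ρ (Conc.principal L a b) = ⊥) :
    (stageGamp θ Set.univ Set.univ).IsQuotientOf (Gamp.ofAlgebra L B) := by
  have hI : ∀ a b, Conc.principal L a b ∈ kerIdeal ρ ↔ θ.r a b := fun a b => (hθ a b).symm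
  obtain ⟨e, he⟩ := exists_orderIso_conc_quo (SemiQuot.mk_isIdealInduced (kerIdeal ρ)) (θ := θ)
    fun a b => (hI a b).symm.trans SemiQuot.mk_eq_bot.symm
  let M := Gamp.ofAlgebra L B
  let I : Order.Ideal M.dist := kerIdeal ρ
  have hδ : ∀ a b : B, e (Conc.principal L (θ.proj a) (θ.proj b)) =
      SemiQuot.mk (kerIdeal ρ) (Conc.principal L a b) := fun a b => by
    rw [← Conc.map_principal, he]
    rfl
  let g : Gamp.Hom (stageGamp θ Set.univ Set.univ) (M.quot I) :=
    { toFun := Quotient.lift (fun c : (Set.univ : Set B) => M.proj I c.1)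
        fun a b hab => Pregamp.proj_eq.2 ((hI a.1 b.1).2 hab)
      distHom := { toFun := e, map_sup' := e.map_sup, map_bot' := e.map_bot }
      map_graph := by
        rintro n f _ _ ⟨x, y, h, rfl, rfl⟩
        exact ⟨fun i => (x i).1, y.1, h, rfl, rfl⟩
      map_δ := fun a b => by
        obtain ⟨a, rfl⟩ := cls_surjective a
        obtain ⟨b, rfl⟩ := cls_surjective b
        exact (hδ a.1 b.1).symm
      map_star := by
        rintro _ ⟨x, hx, rfl⟩
        exact ⟨x.1, hx, rfl⟩
      map_star_graph := by
        rintro n f _ _ ⟨x, y, -, h, rfl, rfl⟩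
        exact ⟨fun i => (x i).1, y.1, h, rfl, rfl⟩ }
  let g' : Gamp.Hom (M.quot I) (stageGamp θ Set.univ Set.univ) :=
    { toFun := Quotient.lift (fun c : B => cls θ (C := Set.univ) ⟨c, Set.mem_univ c⟩)
        fun a b hab => cls_eq.2 ((hI a b).1 hab)
      distHom := { toFun := e.symm, map_sup' := e.symm.map_sup, map_bot' := e.symm.map_bot }
      map_graph := by
        rintro n f _ _ ⟨x, y, h, rfl, rfl⟩
        exact ⟨fun i => ⟨x i, Set.mem_univ _⟩, ⟨y, Set.mem_univ _⟩, h, rfl, rfl⟩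
      map_δ := fun a b => by
        obtain ⟨a, rfl⟩ := M.proj_surjective I a
        obtain ⟨b, rfl⟩ := M.proj_surjective I b
        exact (e.symm_apply_eq.2 (hδ a b).symm).symm
      map_star := by
        rintro _ ⟨x, hx, rfl⟩
        exact ⟨⟨x, Set.mem_univ _⟩, Set.mem_univ _, rfl⟩
      map_star_graph := by
        rintro n f _ _ ⟨x, y, h, rfl, rfl⟩
        exact ⟨fun i => ⟨x i, Set.mem_univ _⟩, ⟨y, Set.mem_univ _⟩,
          ⟨fun _ => Set.mem_univ _, Set.mem_univ _⟩, h, rfl, rfl⟩ }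
  refine ⟨I, g, g', fun a => ?_, fun b => ?_, fun d => e.symm_apply_apply d,
    fun d => e.apply_symm_apply d⟩
  · obtain ⟨a, rfl⟩ := cls_surjective a
    rfl
  · obtain ⟨b, rfl⟩ := M.proj_surjective I b
    rfl

variable {K : FirstOrder.Language.{y, y'}} {P : Type x} [PartialOrder P]

/-- A partial lifting from a system of stages whose quotients of `B` lift `Con_c ∘ A`. -/
theorem exists_partialLifting_of_stages (A : AlgDiagram.{y, y', v, x} K P) {W : Variety L}
    (hB : W.Mem B) (ρ : ∀ p, SupBotHom (Conc L B) (Conc K (A.obj p)))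
    (hρ : ∀ p, IsIdealInduced (ρ p)) (θ : P → Cong L B)
    (hθ : ∀ p a b, (θ p).r a b ↔ ρ p (Conc.principal L a b) = ⊥) (D C₀ C : P → Set B)
    (hstage : ∀ p, IsStage (θ p) (D p) (C₀ p) (C p)) (hCD : ∀ p q, p < q → C p ⊆ D q)
    (hcomp : ∀ p q (h : p < q), ∀ a ∈ C p, ∀ b ∈ C p,
      ρ q (Conc.principal L a b) = Conc.map (A.map h.le) (ρ p (Conc.principal L a b))) :
    ∃ E : GampDiagram.{u, u', w, x} L P, E.IsPartialLifting W ∧ E.LiftsConc A ∧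
      ∀ p, E.obj p = stageGamp (θ p) (C₀ p) (C p) := by
  choose e he using fun p => exists_orderIso_conc_quo (hρ p) (hθ p)
  have hmap_id : ∀ p (α : Conc K (A.obj p)), Conc.map (A.map (le_refl p)) α = α := fun p α => by
    obtain ⟨s, rfl⟩ := α.exists_eq_sup
    rw [map_finset_sup]
    exact Finset.sup_congr rfl fun e _ => by
      rw [Function.comp, Conc.map_principal, A.map_id, A.map_id]
  have hmap_comp : ∀ {p q r} (hpq : p ≤ q) (hqr : q ≤ r) (α : Conc K (A.obj p)),
      Conc.map (A.map hqr) (Conc.map (A.map hpq) α) = Conc.map (A.map (hpq.trans hqr)) α := by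
    intro p q r hpq hqr α
    obtain ⟨s, rfl⟩ := α.exists_eq_sup
    simp only [map_finset_sup, Function.comp_def, Conc.map_principal, A.map_comp]
  have hC : ∀ {p q}, p ≤ q → C p ⊆ C q := fun {p q} hpq => by
    rcases hpq.eq_or_lt with rfl | hpq
    · exact subset_rfl
    · exact (hCD p q hpq).trans ((hstage q).subset.trans (hstage q).subset')
  have hC₀ : ∀ {p q}, p ≤ q → C₀ p ⊆ C₀ q := fun {p q} hpq => by
    rcases hpq.eq_or_lt with rfl | hpq
    · exact subset_rfl
    · exact (hstage p).subset'.trans ((hCD p q hpq).trans (hstage q).subset)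
  -- The map on distances is transported from the diagram `A`. It cannot come from a homomorphism
  -- between the quotients of `B`, since `θ p ≤ θ q` is not assumed.
  let φ : ∀ {p q}, p ≤ q → SupBotHom (Conc L (θ p).Quo) (Conc L (θ q).Quo) := fun {p q} hpq =>
    { toFun := fun α => (e q).symm (Conc.map (A.map hpq) (e p α))
      map_sup' := fun α β => by simp only [map_sup]
      map_bot' := by simp only [map_bot] }
  have hφ : ∀ {p q} (hpq : p ≤ q) (α), e q (φ hpq α) = Conc.map (A.map hpq) (e p α) :=
    fun {p q} hpq α => (e q).apply_symm_apply _
  have hφδ : ∀ {p q} (hpq : p ≤ q), ∀ a ∈ C p, ∀ b ∈ C p,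
      Conc.principal L ((θ q).proj a) ((θ q).proj b) =
        φ hpq (Conc.principal L ((θ p).proj a) ((θ p).proj b)) := fun {p q} hpq a ha b hb => by
    apply (e q).injective
    rw [hφ, ← Conc.map_principal, ← Conc.map_principal, he, he]
    rcases hpq.eq_or_lt with rfl | hpq
    · rw [hmap_id]
    · exact hcomp p q hpq a ha b hb
  refine ⟨{ obj := fun p => stageGamp (θ p) (C₀ p) (C p)
            map := fun {p q} hpq => stageHom (hC₀ hpq) (hC hpq) (φ hpq) (hφδ hpq)
            map_id := fun p a => ?_
            map_id_dist := fun p d => (e p).injective ((hφ _ d).trans (hmap_id p _))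
            map_comp := fun {p q r} hpq hqr a => ?_
            map_comp_dist := fun {p q r} hpq hqr d => (e r).injective ?_ }, ?_, ?_, fun _ => rfl⟩
  · obtain ⟨a, rfl⟩ := cls_surjective a
    rfl
  · obtain ⟨a, rfl⟩ := cls_surjective a
    rfl
  · exact (hφ hqr _).trans ((congrArg _ (hφ hpq d)).trans
      ((hmap_comp hpq hqr _).trans (hφ (hpq.trans hqr) d).symm))
  · exact
      { isOf := fun p => (stageGamp_hasIsomorphicRealization hB).isOf
        strong := fun p => (hstage p).isStrong
        tractable := fun p => (hstage p).isCongruenceTractable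
        generated := fun p => (hstage p).isDistanceGenerated
        realization := fun p => stageGamp_hasIsomorphicRealization hB
        map_strong := fun {p q} h => (hstage q).stageHom_isStrong (hCD p q h)
          (hC₀ := hC₀ h.le) (hφ := hφδ h.le)
        map_cuttable := fun {p q} h => (hstage q).stageHom_isCongruenceCuttable (hCD p q h)
          (hC₀ := hC₀ h.le) (hφ := hφδ h.le) }
  · exact ⟨e, fun h d => hφ h d⟩

end Assembly

end CLLGamp

/-! ### Proof of the Condensate Lifting Lemma -/

namespace CLLGamp

theorem IsIdealInduced.comp_orderIso {S S' T : Type*} [SemilatticeSup S] [OrderBot S]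
    [SemilatticeSup S'] [OrderBot S'] [SemilatticeSup T] [OrderBot T] {h : SupBotHom S T}
    (hh : IsIdealInduced h) (χ : S' ≃o S) :
    IsIdealInduced (h.comp { toFun := χ, map_sup' := χ.map_sup, map_bot' := χ.map_bot }) where
  surjective := hh.surjective.comp χ.surjective
  exists_le a b hab := by
    obtain ⟨c, hc, hle⟩ := hh.exists_le (χ a) (χ b) hab
    refine ⟨χ.symm c, ?_, ?_⟩
    · change h (χ (χ.symm c)) = ⊥
      rwa [χ.apply_symm_apply]
    · rwa [← χ.le_iff_le, map_sup, χ.apply_symm_apply]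

end CLLGamp

/-- The Condensate Lifting Lemma for gamps. -/
theorem theoremT {K : FirstOrder.Language.{u₁, u₂}} [K.IsAlgebraic] {L : FirstOrder.Language.{u₃, u₄}} [L.IsAlgebraic]
    (V : Variety K) (W : Variety L) (hL : Finite (Σ n, L.Functions n))
    {P : Type u₅} [PartialOrder P] {X : Type u₆} [PartialOrder X] (nm : X →o P)
    (Y : Set (Order.Ideal X)) (hXY : IsLifter nm Y)
    (A : AlgDiagram.{u₁, u₂, u₇, u₅} K P) (hA : ∀ p, V.Mem (A.obj p))
    (hfin : ∀ p, ¬ IsMax p → Finite (Conc K (A.obj p)))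
    (B : Type u₈) [L.Structure B] (hB : W.Mem B)
    (hBA : Nonempty (Conc L B ≃o Conc K (condensate A nm hXY.supported))) :
    ∃ D : GampDiagram.{u₃, u₄, u₈, u₅} L P,
      D.IsPartialLifting W ∧ D.LiftsConc A ∧
      (∀ p, ¬ IsMax p → (D.obj p).IsFinite) ∧
      ∀ p, IsMax p → (D.obj p).IsQuotientOf (Gamp.ofAlgebra L B) := by
  classical
  obtain ⟨χ⟩ := hBA
  let ρ : ∀ (I : Order.Ideal X) (p : P), IsNorm nm I p → SupBotHom (Conc L B) (Conc K (A.obj p)) :=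
    fun I p hI => (Conc.map (condensate.proj A hXY.supported hI)).comp
      { toFun := χ, map_sup' := χ.map_sup, map_bot' := χ.map_bot }
  have hρ : ∀ I p hI, IsIdealInduced (ρ I p hI) := fun I p hI =>
    (Conc.map_isIdealInduced (condensate.proj_surjective hI fun p => (hA p).1)).comp_orderIso χ
  let θ : ∀ (I : Order.Ideal X) (p : P), IsNorm nm I p → Cong L B :=
    fun I p hI => Cong.ofIdeal (kerIdeal (ρ I p hI))
  have hθ : ∀ I p hI a b, (θ I p hI).r a b ↔ ρ I p hI (Conc.principal L a b) = ⊥ :=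
    fun _ _ _ _ _ => Iff.rfl
  have hθ_eq : ∀ I p q (hp : IsNorm nm I p) (hq : IsNorm nm I q), θ I p hp = θ I q hq := by
    intro I p q hp hq
    obtain rfl := hp.unique hq
    rfl
  have hθ_fin : ∀ I p hI, ¬ IsMax p → Finite (Conc L (θ I p hI).Quo) := fun I p hI hp => by
    have := hfin p hp
    obtain ⟨e, -⟩ := exists_orderIso_conc_quo (hρ I p hI) (hθ I p hI)
    exact Finite.of_equiv _ e.symm.toEquiv
  -- The tower of finite stages is built over all these ideals before `σ` is known, because the map
  -- `S` that determines `σ` depends on the stages.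
  let T := {I : Order.Ideal X // I ∈ Y ∧ ∃ p, IsNorm nm I p ∧ ¬ IsMax p}
  choose norm hnorm hmax using fun t : T => t.2.2
  have hT : ∀ t : T, (Set.Iio t).Finite := fun t =>
    ((hXY.lower_finite t.1 t.2.1 _ (hnorm t) (hmax t)).preimage
      Subtype.val_injective.injOn).subset fun s (hs : s < t) => ⟨s.2.1, hs.le⟩
  obtain ⟨C₀, C, hCfin, hC⟩ := exists_isStage_tower hL hT (fun t => θ t.1 (norm t) (hnorm t))
    fun t => hθ_fin _ _ _ (hmax t)
  choose supp hsupp using condensate.exists_conc_support A hXY.supported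
  -- The finite set attached to `I` contains supports for all distances between elements of its
  -- stage. Other ideals get `∅`, as nothing has to be controlled there.
  obtain ⟨σ, hσ, hσS⟩ := hXY.exists_section fun I => if hI : I ∈ Y ∧ ∃ p, IsNorm nm I p ∧ ¬ IsMax p
    then ((hCfin ⟨I, hI⟩).toFinset ×ˢ (hCfin ⟨I, hI⟩).toFinset).biUnion
      fun e => supp (χ (Conc.principal L e.1 e.2))
    else ∅
  have hσT : ∀ p, ¬ IsMax p → σ p ∈ Y ∧ ∃ q, IsNorm nm (σ p) q ∧ ¬ IsMax q :=
    fun p hp => ⟨(hσ p).1, p, (hσ p).2, hp⟩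
  let CP : P → Set B := fun p => if hp : IsMax p then Set.univ else C ⟨σ p, hσT p hp⟩
  let CP₀ : P → Set B := fun p => if hp : IsMax p then Set.univ else C₀ ⟨σ p, hσT p hp⟩
  let DP : P → Set B := fun p =>
    if hp : IsMax p then Set.univ else ⋃ s < (⟨σ p, hσT p hp⟩ : T), C s
  have hstage : ∀ p, IsStage (θ (σ p) p (hσ p).2) (DP p) (CP₀ p) (CP p) := by
    intro p
    by_cases hp : IsMax p
    · simp only [DP, CP, CP₀, dif_pos hp]
      exact isStage_univ _ _
    · simp only [DP, CP, CP₀, dif_neg hp]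
      have := hC ⟨σ p, hσT p hp⟩
      rwa [hθ_eq _ _ p _ (hσ p).2] at this
  have hCD : ∀ p q, p < q → CP p ⊆ DP q := by
    intro p q hpq
    by_cases hq : IsMax q
    · simp only [DP, dif_pos hq, Set.subset_univ]
    · have hlt : σ p < σ q := (σ.monotone hpq.le).lt_of_ne fun h =>
        hpq.ne ((hσ p).2.unique (h ▸ (hσ q).2))
      simp only [CP, DP, dif_neg hq, dif_neg hpq.not_isMax]
      exact fun x hx => Set.mem_biUnion (show (⟨σ p, hσT p hpq.not_isMax⟩ : T) < _ from hlt) hx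
  have hcomp : ∀ p q (h : p < q), ∀ a ∈ CP p, ∀ b ∈ CP p,
      ρ (σ q) q (hσ q).2 (Conc.principal L a b) =
        Conc.map (A.map h.le) (ρ (σ p) p (hσ p).2 (Conc.principal L a b)) := by
    intro p q hpq a ha b hb
    have hp := hpq.not_isMax
    simp only [CP, dif_neg hp] at ha hb
    -- The choice of `σ` says precisely that the part of the support lying in `σ q` is already in `σ
    -- p`.
    refine hsupp _ (σ p) (σ q) p q (hσ p).2 (hσ q).2 (σ.monotone hpq.le) hpq.le
      fun v hv => hσS p q hpq v ?_
    rw [dif_pos (hσT p hp)]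
    exact Finset.mem_biUnion.2 ⟨(a, b), Finset.mem_product.2
      ⟨(hCfin _).mem_toFinset.2 ha, (hCfin _).mem_toFinset.2 hb⟩, hv⟩
  obtain ⟨E, hE, hEA, hobj⟩ := exists_partialLifting_of_stages A hB
    (fun p => ρ (σ p) p (hσ p).2) (fun p => hρ _ _ _) (fun p => θ (σ p) p (hσ p).2)
    (fun p => hθ _ _ _) DP CP₀ CP hstage hCD hcomp
  refine ⟨E, hE, hEA, fun p hp => ?_, fun p hp => ?_⟩
  · rw [hobj]
    refine ⟨StageCarrier.finite ?_, hθ_fin _ _ _ hp⟩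
    simp only [CP, dif_neg hp]
    exact hCfin _
  · rw [hobj]
    simp only [CP, CP₀, dif_pos hp]
    exact stageGamp_univ_isQuotientOf (hθ _ _ _)
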